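/- **Proposition (representation formula).** Let $V\in L^\infty(\mathbb R)$ be real-valued and let $0<v_0\le V(x)\le v_1$ for a.e. $x\in\mathbb R$, for some constants $v_0,v_1$. Elements of $H^1(\mathbb R)$ and $W^{k,\infty}_{loc}(\mathbb R)$ are identified with their continuous representatives. Put $\|u\|_V^2:=\int_{\mathbb R}(|u'|^2+V|u|^2)\,dx$ for $u\in H^1(\mathbb R)$, and for $a\in\mathbb R$ put $$K_a:=\{u\in H^1(\mathbb R): u(a)=\|u\|_{L^\infty(\mathbb R)}=1\},\qquad F(a):=\inf_{u\in K_a}\|u\|_V^2 .$$ Then for every $a$ there is a unique minimizer $u_a\in K_a$ of $\|\cdot\|_V^2$ over $K_a$; write $u_a'(a_+)$ and $u_a'(a_-)$ for its right and left derivatives at $a$. Moreover there are unique $\varphi_\pm\in W^{2,\infty}_{loc}(\mathbb R)$ such that $\varphi_\pm''=V\varphi_\pm$ a.e. on $\mathbb R$, $\varphi_\pm(0)=1$ and $\lim_{x\to\pm\infty}\varphi_\pm(x)=0$. The functions $\varphi_\pm$ are positive and differentiable; set $$W:=\varphi_-'(0)-\varphi_+'(0),\quad h_\pm:=\varphi_\pm^2,\quad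 \ell_\pm:=\log\varphi_\pm,\quad H_+(x):=\int_{-\infty}^x\frac{d\xi}{h_+(\xi)},\quad H_-(x):=\int_x^{\infty}\frac{d\xi}{h_-(\xi)},$$ where the two integrals are finite. Then $W>0$; the functions $\ell_\pm$ and $F$ are differentiable on $\mathbb R$ and belong to $W^{2,\infty}_{loc}(\mathbb R)$, with $\ell_\pm'$ and $F'$ differentiable a.e.; and the following hold (upper signs together, lower signs together): $$u_x'(x_\pm)=\frac{\varphi_\pm'(x)}{\varphi_\pm(x)}=\ell_\pm'(x)\quad(x\in\mathbb R),$$ $$\varphi_\mp(x)=W\varphi_\pm(x)H_\pm(x)\quad(x\in\mathbb R),$$ $$V(x)=\ell_\pm''(x)+\ell_\pm'(x)^2\quad(\text{a.e. }x\in\mathbb R),$$ $$F(x)=\ell_-'(x)-\ell_+'(x)\quad(x\in\mathbb R),$$ $$F'(x)=-F(x)\bigl(\ell_+'(x)+\ell_-'(x)\bigr)=-\frac{W F(x)}{\varphi_+(x)\varphi_-(x)}\bigl(h_\pm'(x)H_\pm(x)\pm1\bigr)\quad(x\in\mathbb R),$$ $$F''(x)=-2F'(x)\,\ell_\mp'(x)-2F(x)\,\ell_\pm''(x)\quad(\text{a.e.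 }x\in\mathbb R).$$ -/

import Mathlib

open MeasureTheory Set Filter Topology
open scoped ContDiff ENNReal

/-- `g` is the weak (distributional) derivative of `f` on the real line. -/
def HasWeakDeriv (f g : ℝ → ℝ) : Prop :=
  LocallyIntegrable f volume ∧ LocallyIntegrable g volume ∧
    ∀ η : ℝ → ℝ, ContDiff ℝ ∞ η → HasCompactSupport η →
      ∫ x, f x * deriv η x = -∫ x, g x * η x

/-- `f` belongs to `L^∞_loc(ℝ)`. -/
def IsLInftyLoc (f : ℝ → ℝ) : Prop :=
  ∀ K : Set ℝ, IsCompact K → MemLp f ∞ (volume.restrict K)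

/-- `f` is the continuous representative of an element of `W^{2,∞}_loc(ℝ)`, with weak first and
second derivatives `f₁` and `f₂`. -/
structure IsW2InftyLoc (f f₁ f₂ : ℝ → ℝ) : Prop where
  continuous : Continuous f
  weakDeriv : HasWeakDeriv f f₁
  weakDeriv₂ : HasWeakDeriv f₁ f₂
  bdd : IsLInftyLoc f
  bdd₁ : IsLInftyLoc f₁
  bdd₂ : IsLInftyLoc f₂

/-- `u` is the continuous representative of an element of `H¹(ℝ)`, with weak derivative `u₁`. -/
structure IsH1 (u u₁ : ℝ → ℝ) : Prop where
  continuous : Continuous u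
  memLp : MemLp u 2 volume
  memLp₁ : MemLp u₁ 2 volume
  weakDeriv : HasWeakDeriv u u₁

/-- `‖u‖_V² = ∫ (|u'|² + V |u|²)`, where `u₁` is the weak derivative of `u`. -/
noncomputable def energyV (V u u₁ : ℝ → ℝ) : ℝ :=
  ∫ x, ((u₁ x) ^ 2 + V x * (u x) ^ 2)

/-- `u` (with weak derivative `u₁`) belongs to `K_a = {u ∈ H¹(ℝ) ; u(a) = ‖u‖_∞ = 1}`. -/
structure IsInK (a : ℝ) (u u₁ : ℝ → ℝ) : Prop where
  isH1 : IsH1 u u₁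
  value : u a = 1
  norm : eLpNorm u ∞ volume = 1

/-- `F(a) = inf_{u ∈ K_a} ‖u‖_V²`. -/
noncomputable def infK (V : ℝ → ℝ) (a : ℝ) : ℝ :=
  sInf {E : ℝ | ∃ u u₁ : ℝ → ℝ, IsInK a u u₁ ∧ E = energyV V u u₁}

/-- `u` minimizes `‖·‖_V²` over `K_a`. -/
def IsMinimizerK (V : ℝ → ℝ) (a : ℝ) (u : ℝ → ℝ) : Prop :=
  ∃ u₁ : ℝ → ℝ, IsInK a u u₁ ∧
    ∀ w w₁ : ℝ → ℝ, IsInK a w w₁ → energyV V u u₁ ≤ energyV V w w₁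

/-- `φ ∈ W^{2,∞}_loc(ℝ)`, `φ'' = V φ` a.e., `φ(0) = 1` and `φ → 0` along the filter `l`
(`l = atTop` for `φ₊`, `l = atBot` for `φ₋`). -/
def IsDecayingSolution (V : ℝ → ℝ) (l : Filter ℝ) (φ : ℝ → ℝ) : Prop :=
  (∃ φ₁ φ₂ : ℝ → ℝ, IsW2InftyLoc φ φ₁ φ₂ ∧ ∀ᵐ x, φ₂ x = V x * φ x) ∧
    φ 0 = 1 ∧ Tendsto φ l (𝓝 0)

/-- `ℓ = log φ`. -/
noncomputable def logFun (φ : ℝ → ℝ) (x : ℝ) : ℝ := Real.log (φ x)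

/-- `h = φ²`. -/
def sqFun (φ : ℝ → ℝ) (x : ℝ) : ℝ := (φ x) ^ 2

/-- `H₊(x) = ∫_{-∞}^x dξ / h₊(ξ)`, as a function of `φ₊`. -/
noncomputable def HPlus (φ : ℝ → ℝ) (x : ℝ) : ℝ := ∫ ξ in Iic x, 1 / sqFun φ ξ

/-- `H₋(x) = ∫_x^∞ dξ / h₋(ξ)`, as a function of `φ₋`. -/
noncomputable def HMinus (φ : ℝ → ℝ) (x : ℝ) : ℝ := ∫ ξ in Ici x, 1 / sqFun φ ξ

/-! Everything rests on the logarithmic derivatives `r = φ'/φ` of positive solutions of `φ'' = V φ`,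
which satisfy the Riccati equation `r' = V - r²`. It lets one complete the square: `w'² + V w² = (w'
- r w)² + (r w²)'`. Use `r₋` to the left of `a` and `r₊` to the right. The boundary terms at
infinity vanish, since `|r±| ≤ √v₁` and `w² → 0`, so the energy of `w` is two integrals of squares
plus `(r₋(a) - r₊(a)) w(a)²` (`IsDecayingPair.energy_eq`). With `w(a) = 1` this is least exactly
when both squares vanish, i.e. when `w` is proportional to `φ₋` on the left and to `φ₊` on the
right. This `peak` lies in `K_a` because `φ₋` increases and `φ₊` decreases. Hence `F = r₋ - r₊`.

The Wronskian `W` is constant, so `F = W / (φ₊ φ₋)` and `(φ₋/φ₊)' = W/φ₊²`. The formulas for `H±`,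
`F'` and `F''` follow by calculus and Riccati.

The solution `φ₊` is built as `C - S/L`, where `C`, `S` are the fundamental solutions at `0` and `L
= lim S/C` (`IsPotential.exists_isDecaying`); `φ₋` comes from reflection. Comparison and uniqueness
arguments use that `φ φ'` is nondecreasing for every solution. Weak and classical notions are
matched by the du Bois-Reymond lemma. -/

/-! ### Calculus of locally absolutely continuous functions. -/

/-- `f` is locally absolutely continuous on the line with a.e. derivative `g`. -/
structure IsPrimitive (f g : ℝ → ℝ) : Prop where
  locInt : LocallyIntegrable g volume
  integral_eq : ∀ x y, ∫ t in x..y, g t = f y - f x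

namespace IsPrimitive

variable {f g f' g' : ℝ → ℝ}

theorem intervalIntegrable (h : IsPrimitive f f') (x y : ℝ) :
    IntervalIntegrable f' volume x y :=
  (h.locInt.integrableOn_isCompact isCompact_uIcc).intervalIntegrable

theorem eq_add_integral (h : IsPrimitive f f') (a : ℝ) :
    f = fun x => f a + ∫ t in a..x, f' t := by
  funext x; rw [h.integral_eq]; ring

theorem of_integral_from (hg : LocallyIntegrable g volume) (a : ℝ)
    (h : ∀ x, ∫ t in a..x, g t = f x - f a) : IsPrimitive f g := by
  refine ⟨hg, fun x y => ?_⟩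
  have hi : ∀ x y, IntervalIntegrable g volume x y := fun x y =>
    (hg.integrableOn_isCompact isCompact_uIcc).intervalIntegrable
  rw [← intervalIntegral.integral_interval_sub_left (hi a y) (hi a x), h, h]; ring

theorem continuous (h : IsPrimitive f f') : Continuous f := by
  rw [h.eq_add_integral 0]
  exact continuous_const.add (intervalIntegral.continuous_primitive h.intervalIntegrable 0)

theorem absolutelyContinuous (h : IsPrimitive f f') (x y : ℝ) :
    AbsolutelyContinuousOnInterval f x y := by
  have h1 := (h.intervalIntegrable x y).absolutelyContinuousOnInterval_intervalIntegral
    (c := x) left_mem_uIcc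
  have h2 : AbsolutelyContinuousOnInterval (fun _ : ℝ => f x) x y :=
    (LipschitzWith.const (f x)).lipschitzOnWith.absolutelyContinuousOnInterval (K := 0)
  have := h2.add h1
  rw [h.eq_add_integral x]
  exact this

theorem ae_hasDerivAt (h : IsPrimitive f f') : ∀ᵐ x, HasDerivAt f (f' x) x := by
  filter_upwards [LocallyIntegrable.ae_hasDerivAt_integral h.locInt] with x hx
  rw [h.eq_add_integral 0]
  exact (hx 0).const_add _

theorem ae_deriv (h : IsPrimitive f f') : ∀ᵐ x, deriv f x = f' x := by
  filter_upwards [h.ae_hasDerivAt] with x hx using hx.deriv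

theorem congr_ae (h : IsPrimitive f f') (hg : f' =ᵐ[volume] g) : IsPrimitive f g := by
  refine ⟨h.locInt.congr hg, fun x y => ?_⟩
  rw [← h.integral_eq]
  exact (intervalIntegral.integral_congr_ae (by filter_upwards [hg] with t ht _ using ht)).symm

theorem deriv_self (h : IsPrimitive f f') : IsPrimitive f (deriv f) :=
  h.congr_ae (by filter_upwards [h.ae_deriv] with x hx using hx.symm)

theorem of_hasDerivAt (h : ∀ x, HasDerivAt f (f' x) x) (hc : Continuous f') :
    IsPrimitive f f' :=
  ⟨hc.locallyIntegrable, fun x y =>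
    intervalIntegral.integral_eq_sub_of_hasDerivAt (fun t _ => h t) (hc.intervalIntegrable x y)⟩

theorem hasDerivAt (h : IsPrimitive f f') (hc : Continuous f') (x : ℝ) :
    HasDerivAt f (f' x) x := by
  rw [h.eq_add_integral 0]
  exact (intervalIntegral.integral_hasDerivAt_right (h.intervalIntegrable _ _)
    hc.stronglyMeasurable.stronglyMeasurableAtFilter hc.continuousAt).const_add _

theorem add (hf : IsPrimitive f f') (hg : IsPrimitive g g') :
    IsPrimitive (fun x => f x + g x) (fun x => f' x + g' x) := by
  refine ⟨hf.locInt.add hg.locInt, fun x y => ?_⟩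
  rw [intervalIntegral.integral_add (hf.intervalIntegrable x y) (hg.intervalIntegrable x y),
    hf.integral_eq, hg.integral_eq]
  ring

theorem const_mul (hf : IsPrimitive f f') (c : ℝ) :
    IsPrimitive (fun x => c * f x) (fun x => c * f' x) := by
  refine ⟨hf.locInt.smul c, fun x y => ?_⟩
  rw [intervalIntegral.integral_const_mul, hf.integral_eq]
  ring

theorem neg (hf : IsPrimitive f f') : IsPrimitive (fun x => -f x) (fun x => -f' x) := by
  simpa using hf.const_mul (-1)

theorem sub (hf : IsPrimitive f f') (hg : IsPrimitive g g') :
    IsPrimitive (fun x => f x - g x) (fun x => f' x - g' x) := by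
  simpa [sub_eq_add_neg] using hf.add hg.neg

theorem mul (hf : IsPrimitive f f') (hg : IsPrimitive g g') :
    IsPrimitive (fun x => f x * g x) (fun x => f' x * g x + f x * g' x) := by
  refine ⟨(hf.locInt.mul_continuous hg.continuous).add
    (hg.locInt.continuous_mul hf.continuous), fun x y => ?_⟩
  rw [← (hf.absolutelyContinuous x y).integral_deriv_mul_eq_sub (hg.absolutelyContinuous x y)]
  refine intervalIntegral.integral_congr_ae ?_
  filter_upwards [hf.ae_deriv, hg.ae_deriv] with t h1 h2 _
  rw [h1, h2]

theorem comp_neg (hf : IsPrimitive f f') :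
    IsPrimitive (fun x => f (-x)) (fun x => -f' (-x)) := by
  refine ⟨?_, fun x y => ?_⟩
  · have : LocallyIntegrable (fun x => f' (-x)) volume := by
      rw [locallyIntegrable_iff]
      intro K hK
      have := hf.locInt.integrableOn_isCompact hK.neg
      simpa using this.comp_neg
    exact this.neg
  · rw [intervalIntegral.integral_neg, intervalIntegral.integral_comp_neg (fun t => f' t),
      hf.integral_eq]
    ring

theorem monotoneOn (hf : IsPrimitive f f') (a : ℝ) (h : ∀ᵐ x, a ≤ x → 0 ≤ f' x) :
    MonotoneOn f (Ici a) := by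
  intro x hx y hy hxy
  rw [← sub_nonneg, ← hf.integral_eq]
  refine intervalIntegral.integral_nonneg_of_ae_restrict hxy ?_
  rw [EventuallyLE, ae_restrict_iff' measurableSet_Icc]
  filter_upwards [h] with t ht h2 using ht (le_trans hx h2.1)

theorem monotone (hf : IsPrimitive f f') (h : ∀ᵐ x, 0 ≤ f' x) : Monotone f := by
  intro x y hxy
  exact hf.monotoneOn x (by filter_upwards [h] with t ht _ using ht) self_mem_Ici hxy hxy

theorem congr_fun {x y : ℝ} (hf : IsPrimitive f f') (h : ∀ᵐ x, f' x = 0) : f x = f y := by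
  have := hf.integral_eq x y
  rw [intervalIntegral.integral_zero_ae (by filter_upwards [h] with t ht _ using ht)] at this
  linarith

theorem integral_Ioi (hf : IsPrimitive f f') {a l : ℝ} (hi : IntegrableOn f' (Ioi a))
    (hl : Tendsto f atTop (𝓝 l)) : ∫ t in Ioi a, f' t = l - f a := by
  refine tendsto_nhds_unique (intervalIntegral_tendsto_integral_Ioi a hi tendsto_id) ?_
  simp only [hf.integral_eq, id]
  exact hl.sub_const _

theorem integral_Iic (hf : IsPrimitive f f') {a l : ℝ} (hi : IntegrableOn f' (Iic a))
    (hl : Tendsto f atBot (𝓝 l)) : ∫ t in Iic a, f' t = f a - l := by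
  refine tendsto_nhds_unique (intervalIntegral_tendsto_integral_Iic a hi tendsto_id) ?_
  simp only [hf.integral_eq, id]
  exact hl.const_sub _

/-- A locally absolutely continuous function that is integrable at `+∞` together with its
derivative tends to `0`. -/
theorem tendsto_zero (hf : IsPrimitive f f') (hi : Integrable f) (hi' : Integrable f') :
    Tendsto f atTop (𝓝 0) := by
  have h := (intervalIntegral_tendsto_integral_Ioi 0 hi'.integrableOn tendsto_id).const_add (f 0)
  simp only [hf.integral_eq, id, add_sub_cancel] at h
  -- Integrability of `f'` gives a limit; integrability of `f` near `+∞`, where every neighbourhood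
  -- has infinite measure, forces it to be `0`.
  have h0 := IntegrableAtFilter.eq_zero_of_tendsto (μ := volume) (l := (atTop : Filter ℝ))
    ⟨univ, univ_mem, hi.integrableOn⟩ (fun s hs => by
      obtain ⟨b, hb⟩ := mem_atTop_sets.1 hs
      exact top_le_iff.1 ((by simp : (⊤ : ℝ≥0∞) ≤ volume (Ici b)).trans (measure_mono hb))) h
  rwa [h0] at h

theorem tendsto_zero_atBot (hf : IsPrimitive f f') (hi : Integrable f) (hi' : Integrable f') :
    Tendsto f atBot (𝓝 0) := by
  have := (hf.comp_neg.tendsto_zero hi.comp_neg hi'.comp_neg.neg).comp tendsto_neg_atBot_atTop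
  simpa [Function.comp_def] using this

theorem hasWeakDeriv (hf : IsPrimitive f f') : HasWeakDeriv f f' := by
  refine ⟨hf.continuous.locallyIntegrable, hf.locInt, fun η hη hs => ?_⟩
  have hη' : IsPrimitive η (deriv η) := of_hasDerivAt
    (fun x => (hη.differentiable (by simp)).differentiableAt.hasDerivAt)
    (hη.continuous_deriv (by simp))
  have hm := hf.mul hη'
  obtain ⟨R, hR⟩ := hs.isBounded.subset_closedBall 0
  -- The margin `|R| + 1` puts the support strictly inside, so that the boundary terms at the
  -- endpoints vanish too.
  have hz : ∀ x, x ∉ Ioo (-(|R| + 1)) (|R| + 1) → η x = 0 ∧ deriv η x = 0 := by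
    intro x hx
    have hx' : x ∉ tsupport η := fun h => hx (by
      have := hR h
      rw [Metric.mem_closedBall, dist_zero_right, Real.norm_eq_abs] at this
      have := abs_le.1 (this.trans (le_abs_self R))
      constructor <;> linarith [this.1, this.2])
    exact ⟨image_eq_zero_of_notMem_tsupport hx', Function.notMem_support.1
      fun h => hx' (support_deriv_subset h)⟩
  have key : ∀ k : ℝ → ℝ, (∀ x, x ∉ Ioc (-(|R| + 1)) (|R| + 1) → k x = 0) →
      ∫ x, k x = ∫ x in (-(|R| + 1))..(|R| + 1), k x := by
    intro k hk
    rw [intervalIntegral.integral_of_le (by linarith [abs_nonneg R])]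
    exact (setIntegral_eq_integral_of_forall_compl_eq_zero hk).symm
  have h0 := hm.integral_eq (-(|R| + 1)) (|R| + 1)
  have hc : ∀ x, x ∉ Ioc (-(|R| + 1)) (|R| + 1) → x ∉ Ioo (-(|R| + 1)) (|R| + 1) :=
    fun x hx h => hx (Ioo_subset_Ioc_self h)
  rw [key _ fun x hx => by rw [(hz x (hc x hx)).2, mul_zero],
    key _ fun x hx => by rw [(hz x (hc x hx)).1, mul_zero], eq_neg_iff_add_eq_zero, add_comm,
    ← intervalIntegral.integral_add
      ((hf.locInt.mul_continuous hη.continuous).integrableOn_isCompact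
        isCompact_uIcc).intervalIntegrable
      ((hη'.locInt.continuous_mul hf.continuous).integrableOn_isCompact
        isCompact_uIcc).intervalIntegrable, h0, (hz (|R| + 1) (by simp)).1,
    (hz (-(|R| + 1)) (by simp)).1]
  simp

end IsPrimitive

/-! ### Weak derivatives and the du Bois-Reymond lemma. -/

/-- A compactly supported smooth function with vanishing integral is the derivative of a
compactly supported smooth function. -/
theorem exists_antideriv_of_integral_eq_zero {η : ℝ → ℝ} (hη : ContDiff ℝ ∞ η)
    (hs : HasCompactSupport η) (h0 : ∫ x, η x = 0) :
    ∃ θ : ℝ → ℝ, ContDiff ℝ ∞ θ ∧ HasCompactSupport θ ∧ deriv θ = η := by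
  have hint : Integrable η := hη.continuous.integrable_of_hasCompactSupport hs
  obtain ⟨R, hR⟩ := hs.isBounded.subset_closedBall 0
  have hz : ∀ x, R < |x| → η x = 0 := fun x hx => image_eq_zero_of_notMem_tsupport fun h => by
    have := hR h
    rw [Metric.mem_closedBall, dist_zero_right, Real.norm_eq_abs] at this
    linarith
  have hd : ∀ x, HasDerivAt (fun x => ∫ t in (-(|R| + 1))..x, η t) (η x) x := fun x =>
    intervalIntegral.integral_hasDerivAt_right (hη.continuous.intervalIntegrable _ _)
      hη.continuous.stronglyMeasurable.stronglyMeasurableAtFilter hη.continuous.continuousAt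
  have hderiv : deriv (fun x => ∫ t in (-(|R| + 1))..x, η t) = η := funext fun x => (hd x).deriv
  refine ⟨_, ?_, ?_, hderiv⟩
  · rw [contDiff_infty_iff_deriv, hderiv]
    exact ⟨fun x => (hd x).differentiableAt, hη⟩
  · refine HasCompactSupport.intro (isCompact_Icc (a := -(|R| + 1)) (b := |R| + 1)) fun x hx => ?_
    rw [mem_Icc, not_and_or, not_le, not_le] at hx
    rcases hx with hx | hx
    · rw [intervalIntegral.integral_symm, neg_eq_zero]
      refine intervalIntegral.integral_zero_ae (ae_of_all _ fun t ht => hz t ?_)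
      rw [uIoc_of_le hx.le] at ht
      exact (le_abs_self R).trans_lt ((by linarith [ht.2] : |R| < -t).trans_le (neg_le_abs t))
    -- To the right of the support the primitive equals the full integral of `η`, which is `0`.
    · rw [← h0, intervalIntegral.integral_of_le (by linarith [abs_nonneg R])]
      refine setIntegral_eq_integral_of_forall_compl_eq_zero fun t ht => hz t ?_
      rw [mem_Ioc, not_and_or, not_lt, not_le] at ht
      rcases ht with ht | ht
      · exact (le_abs_self R).trans_lt ((by linarith : |R| < -t).trans_le (neg_le_abs t))
      · exact (le_abs_self R).trans_lt ((by linarith : |R| < t).trans_le (le_abs_self t))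

/-- A locally integrable function with vanishing weak derivative is a.e. constant. -/
theorem ae_const_of_integral_mul_deriv_eq_zero {f : ℝ → ℝ} (hf : LocallyIntegrable f volume)
    (h : ∀ η : ℝ → ℝ, ContDiff ℝ ∞ η → HasCompactSupport η → ∫ x, f x * deriv η x = 0) :
    ∃ c, ∀ᵐ x, f x = c := by
  obtain ⟨ψ, hψs, hψ, hψ1⟩ : ∃ ψ : ℝ → ℝ, HasCompactSupport ψ ∧ ContDiff ℝ ∞ ψ ∧
      ∫ x, ψ x = 1 := by
    let b : ContDiffBump (0 : ℝ) := ⟨1, 2, one_pos, one_lt_two⟩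
    exact ⟨b.normed volume, b.hasCompactSupport_normed, b.contDiff_normed, b.integral_normed⟩
  have hi : ∀ {η : ℝ → ℝ}, ContDiff ℝ ∞ η → HasCompactSupport η →
      Integrable (fun x => f x * η x) := fun hη hs => by
    simpa [mul_comm] using hf.integrable_smul_left_of_hasCompactSupport hη.continuous hs
  refine ⟨∫ x, f x * ψ x, ?_⟩
  have key := ae_eq_zero_of_integral_contDiff_smul_eq_zero (μ := volume)
    (f := fun x => f x - ∫ x, f x * ψ x) (hf.sub (locallyIntegrable_const _)) fun η hη hs => ?_
  · filter_upwards [key] with x hx using sub_eq_zero.1 hx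
  have hηi : Integrable η := hη.continuous.integrable_of_hasCompactSupport hs
  have hψi : Integrable ψ := hψ.continuous.integrable_of_hasCompactSupport hψs
  -- Removing the multiple of `ψ` with the same mass makes any test function a derivative, against
  -- which `f` integrates to `0`.
  obtain ⟨θ, hθ, hθs, hθd⟩ := exists_antideriv_of_integral_eq_zero
    (η := fun x => η x - (∫ y, η y) * ψ x) (hη.sub (contDiff_const.mul hψ))
    (hs.sub (hψs.mul_left (f := fun _ => ∫ y, η y)))
    (by rw [integral_sub hηi (hψi.const_mul _), integral_const_mul, hψ1]; ring)
  have h1 := h θ hθ hθs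
  rw [hθd] at h1
  have e1 : ∀ x, f x * (η x - (∫ y, η y) * ψ x) = f x * η x - (∫ y, η y) * (f x * ψ x) :=
    fun x => by ring
  have e2 : ∀ x, η x • (f x - ∫ x, f x * ψ x) = f x * η x - (∫ x, f x * ψ x) * η x :=
    fun x => by rw [smul_eq_mul]; ring
  simp only [e1, e2] at h1 ⊢
  rw [integral_sub (hi hη hs) ((hi hψ hψs).const_mul _), integral_const_mul] at h1
  rw [integral_sub (hi hη hs) (hηi.const_mul _), integral_const_mul, mul_comm, h1]

/-- The difference of `f` and the integral of `g` has zero weak derivative, hence is a.e. constant.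
-/
theorem HasWeakDeriv.exists_isPrimitive {f g : ℝ → ℝ} (h : HasWeakDeriv f g) :
    ∃ F, IsPrimitive F g ∧ f =ᵐ[volume] F := by
  obtain ⟨hf, hg, hw⟩ := h
  have hG : IsPrimitive (fun x => ∫ t in (0 : ℝ)..x, g t) g :=
    IsPrimitive.of_integral_from hg 0 fun x => by simp
  have hGc := hG.continuous
  obtain ⟨-, -, hGw⟩ := hG.hasWeakDeriv
  obtain ⟨c, hc⟩ := ae_const_of_integral_mul_deriv_eq_zero
    (hf.sub hGc.locallyIntegrable) fun η hη hs => by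
      have hi : ∀ {k : ℝ → ℝ}, LocallyIntegrable k volume →
          Integrable (fun x => k x * deriv η x) := fun hk => by
        simpa [mul_comm] using hk.integrable_smul_left_of_hasCompactSupport
          (hη.continuous_deriv (by simp)) hs.deriv
      simp only [Pi.sub_apply, sub_mul]
      rw [integral_sub (hi hf) (hi hGc.locallyIntegrable), hw η hη hs, hGw η hη hs, sub_self]
  refine ⟨fun x => c + ∫ t in (0 : ℝ)..x, g t, ⟨hg, fun x y => ?_⟩, ?_⟩
  · rw [hG.integral_eq]; ring
  · filter_upwards [hc] with x hx
    rw [← hx]; simp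

theorem HasWeakDeriv.isPrimitive {f g : ℝ → ℝ} (h : HasWeakDeriv f g) (hf : Continuous f) :
    IsPrimitive f g := by
  obtain ⟨F, hF, hfF⟩ := h.exists_isPrimitive
  rwa [Continuous.ae_eq_iff_eq volume hf hF.continuous |>.1 hfF]

theorem Continuous.isLInftyLoc {f : ℝ → ℝ} (hf : Continuous f) : IsLInftyLoc f := by
  intro K hK
  obtain ⟨C, hC⟩ := hK.exists_bound_of_continuousOn hf.continuousOn
  refine memLp_top_of_bound hf.aestronglyMeasurable C ?_
  rw [ae_restrict_iff' hK.measurableSet]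
  exact ae_of_all _ hC

theorem IsLInftyLoc.congr {f g : ℝ → ℝ} (hf : IsLInftyLoc f) (h : f =ᵐ[volume] g) :
    IsLInftyLoc g := fun K hK => (hf K hK).ae_eq (ae_restrict_of_ae h)

/-! ### The equation `φ'' = V φ`: initial value problem, Wronskian, comparison. -/

/-- `V` is measurable and lies a.e. between the positive constants `v₀` and `v₁`. -/
structure IsPotential (V : ℝ → ℝ) (v₀ v₁ : ℝ) : Prop where
  aesm : AEStronglyMeasurable V volume
  pos : 0 < v₀
  bound : ∀ᵐ x, v₀ ≤ V x ∧ V x ≤ v₁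

namespace IsPotential

variable {V : ℝ → ℝ} {v₀ v₁ : ℝ}

theorem v₁_pos (hV : IsPotential V v₀ v₁) : 0 < v₁ := by
  obtain ⟨x, hx⟩ := hV.bound.exists
  linarith [hx.1, hx.2, hV.pos]

theorem ae_abs_le (hV : IsPotential V v₀ v₁) : ∀ᵐ x, |V x| ≤ v₁ := by
  filter_upwards [hV.bound] with x hx
  rw [abs_of_nonneg (hV.pos.le.trans hx.1)]
  exact hx.2

theorem memLp_top (hV : IsPotential V v₀ v₁) : MemLp V ∞ volume :=
  memLp_top_of_bound hV.aesm v₁ hV.ae_abs_le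

theorem locallyIntegrable_mul (hV : IsPotential V v₀ v₁) {f : ℝ → ℝ} (hf : Continuous f) :
    LocallyIntegrable (fun x => V x * f x) volume :=
  (hV.memLp_top.locallyIntegrable le_top).mul_continuous hf

theorem isLInftyLoc (hV : IsPotential V v₀ v₁) : IsLInftyLoc V :=
  fun _ _ => hV.memLp_top.restrict _

theorem comp_neg (hV : IsPotential V v₀ v₁) : IsPotential (fun x => V (-x)) v₀ v₁ :=
  ⟨hV.aesm.comp_measurePreserving (Measure.measurePreserving_neg volume), hV.pos,
    (Measure.measurePreserving_neg volume).quasiMeasurePreserving.ae hV.bound⟩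

end IsPotential

/-- In the weight `exp (k |x|)` each integration gains a factor `1/k`, which makes the Picard
operator a contraction on the whole line at once. -/
theorem abs_integral_le_exp {f : ℝ → ℝ} {M k : ℝ} (hk : 0 < k)
    (hf : ∀ᵐ t, |f t| ≤ M * Real.exp (k * |t|)) (x : ℝ) :
    |∫ t in (0 : ℝ)..x, f t| ≤ M / k * Real.exp (k * |x|) := by
  have hM : 0 ≤ M := by
    obtain ⟨t, ht⟩ := hf.exists
    exact nonneg_of_mul_nonneg_left ((abs_nonneg _).trans ht) (Real.exp_pos _)
  have main : ∀ (f : ℝ → ℝ), (∀ᵐ t, |f t| ≤ M * Real.exp (k * |t|)) → ∀ x, 0 ≤ x →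
      |∫ t in (0 : ℝ)..x, f t| ≤ M / k * Real.exp (k * |x|) := by
    intro f hf x hx
    have hi : ∫ t in (0 : ℝ)..x, M * Real.exp (k * t) = M / k * (Real.exp (k * x) - 1) := by
      rw [intervalIntegral.integral_eq_sub_of_hasDerivAt (f := fun t => M / k * Real.exp (k * t))
        (fun t _ => ?_) (Continuous.intervalIntegrable (by fun_prop) _ _)]
      · simp; ring
      · exact (((hasDerivAt_id t).const_mul k).exp.const_mul (M / k)).congr_deriv
          (by simp; field_simp)
    calc |∫ t in (0 : ℝ)..x, f t| ≤ ∫ t in (0 : ℝ)..x, M * Real.exp (k * t) := by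
          rw [← Real.norm_eq_abs]
          refine intervalIntegral.norm_integral_le_of_norm_le hx ?_
            (Continuous.intervalIntegrable (μ := volume)
              (u := fun t => M * Real.exp (k * t)) (by fun_prop) _ _)
          filter_upwards [hf] with t ht h2
          rwa [abs_of_pos h2.1] at ht
      _ ≤ _ := by
          rw [hi, abs_of_nonneg hx]
          have : 0 ≤ M / k := by positivity
          nlinarith
  rcases le_total 0 x with hx | hx
  · exact main f hf x hx
  · have := main (fun t => f (-t)) (by
      have := (Measure.measurePreserving_neg (volume : Measure ℝ)).quasiMeasurePreserving.ae hf
      simpa using this) (-x) (by linarith)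
    rwa [intervalIntegral.integral_comp_neg, neg_zero, neg_neg, abs_neg,
      intervalIntegral.integral_symm, abs_neg] at this

/-- `φ` solves `φ'' = V φ` on the line and `ψ = φ'`. -/
structure IsSol (V φ ψ : ℝ → ℝ) : Prop where
  hasDerivAt : ∀ x, HasDerivAt φ (ψ x) x
  isPrimitive : IsPrimitive ψ (fun x => V x * φ x)

/-- Banach's fixed point theorem for `φ = α + β x + ∬ V φ`, written for the bounded unknown `b = φ /
exp (k |x|)`. -/
theorem IsPotential.exists_isSol {V : ℝ → ℝ} {v₀ v₁ : ℝ} (hV : IsPotential V v₀ v₁) (α β : ℝ) :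
    ∃ φ ψ, IsSol V φ ψ ∧ φ 0 = α ∧ ψ 0 = β := by
  have hv₁ := hV.v₁_pos
  -- Two integrations cost `v₁ / k²`, and `v₁ / (v₁ + 1)² ≤ 1/2`.
  set k : ℝ := v₁ + 1 with hk
  have hk0 : 0 < k := by positivity
  let e : ℝ → ℝ := fun x => Real.exp (k * |x|)
  have he : Continuous e := by fun_prop
  have he0 : ∀ x, 0 < e x := fun x => Real.exp_pos _
  let J : (ℝ → ℝ) → ℝ → ℝ := fun b x => ∫ t in (0 : ℝ)..x, V t * (e t * b t)
  have hJ : ∀ {b : ℝ → ℝ}, Continuous b → IsPrimitive (J b) (fun t => V t * (e t * b t)) :=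
    fun hb => .of_integral_from (hV.locallyIntegrable_mul (he.mul hb)) 0 fun x => by simp [J]
  let JJ : (ℝ → ℝ) → ℝ → ℝ := fun b x => ∫ t in (0 : ℝ)..x, J b t
  have hJJ : ∀ {b : ℝ → ℝ}, Continuous b → IsPrimitive (JJ b) (J b) :=
    fun hb => .of_integral_from (hJ hb).continuous.locallyIntegrable 0 fun x => by simp [JJ]
  have hJJb : ∀ {b : ℝ → ℝ} {B : ℝ}, (∀ x, |b x| ≤ B) → ∀ x, |JJ b x| ≤ 1 / 2 * B * e x := by
    intro b B hb x
    have hB : 0 ≤ B := (abs_nonneg _).trans (hb 0)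
    have h1 : ∀ x, |J b x| ≤ v₁ * B / k * e x := abs_integral_le_exp hk0 (by
      filter_upwards [hV.ae_abs_le] with t ht
      rw [abs_mul, abs_mul, abs_of_pos (he0 t), mul_comm (e t), ← mul_assoc]
      exact mul_le_mul_of_nonneg_right (mul_le_mul ht (hb t) (abs_nonneg _) hv₁.le) (he0 t).le)
    refine (abs_integral_le_exp hk0 (ae_of_all _ h1) x).trans
      (mul_le_mul_of_nonneg_right ?_ (he0 x).le)
    rw [div_div, div_le_iff₀ (by positivity)]
    nlinarith [sq_nonneg (v₁ - 1), mul_nonneg hB (sq_nonneg v₁), hk]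
  let T : BoundedContinuousFunction ℝ ℝ → BoundedContinuousFunction ℝ ℝ := fun b =>
    BoundedContinuousFunction.ofNormedAddCommGroup (fun x => (α + β * x + JJ b x) / e x)
      (((by fun_prop : Continuous fun x : ℝ => α + β * x).add (hJJ b.continuous).continuous).div
        he fun x => (he0 x).ne') (|α| + |β| / k + 1 / 2 * ‖b‖) fun x => by
      rw [Real.norm_eq_abs, abs_div, abs_of_pos (he0 x), div_le_iff₀ (he0 x)]
      have h1 := hJJb (b := b) b.norm_coe_le_norm x
      have h2 : |x| ≤ e x / k := by
        rw [le_div_iff₀ hk0]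
        linarith [Real.add_one_le_exp (k * |x|), mul_comm k |x|]
      have h3 : 1 ≤ e x := Real.one_le_exp (by positivity)
      calc |α + β * x + JJ b x| ≤ |α| + |β| * |x| + |JJ b x| := by
            rw [← abs_mul]
            exact (abs_add_le _ _).trans (add_le_add_left (abs_add_le _ _) _)
        _ ≤ |α| * e x + |β| * (e x / k) + 1 / 2 * ‖b‖ * e x := by
            gcongr
            exact le_mul_of_one_le_right (abs_nonneg _) h3
        _ = _ := by ring
  have hT : ContractingWith (1 / 2) T := by
    refine ⟨by norm_num, LipschitzWith.of_dist_le_mul fun b c => ?_⟩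
    rw [BoundedContinuousFunction.dist_le (by positivity)]
    intro x
    have hsub : JJ b x - JJ c x = JJ (fun x => b x - c x) x := by
      have hJs : ∀ x, J b x - J c x = J (fun x => b x - c x) x := fun x => by
        have := ((hJ b.continuous).sub (hJ c.continuous)).integral_eq 0 x
        simp only [J, intervalIntegral.integral_same, sub_zero] at this ⊢
        rw [← this]
        congr 1; funext t; ring
      have := ((hJJ b.continuous).sub (hJJ c.continuous)).integral_eq 0 x
      simp only [hJs] at this
      simp only [JJ, intervalIntegral.integral_same, sub_zero] at this ⊢
      exact this.symm
    have h1 := hJJb (b := fun x => b x - c x) (B := dist b c)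
      (fun x => b.dist_coe_le_dist x) x
    change dist ((α + β * x + JJ b x) / e x) ((α + β * x + JJ c x) / e x) ≤ _
    rw [Real.dist_eq, ← sub_div, add_sub_add_left_eq_sub, hsub, abs_div, abs_of_pos (he0 x),
      div_le_iff₀ (he0 x)]
    simpa using h1
  obtain ⟨b, hb⟩ : ∃ b, T b = b := ⟨_, hT.fixedPoint_isFixedPt⟩
  have hφ : ∀ x, e x * b x = α + β * x + JJ b x := fun x => by
    have : (α + β * x + JJ b x) / e x = b x := congrArg (fun f => f x) hb
    rw [← this, mul_div_cancel₀ _ (he0 x).ne']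
  refine ⟨fun x => e x * b x, fun x => β + J b x, ⟨fun x => ?_, (hJ b.continuous).locInt,
    fun x y => ?_⟩, by simp [hφ, JJ], by simp [J]⟩
  · simp only [hφ]
    have := (hJJ b.continuous).hasDerivAt (hJ b.continuous).continuous x
    exact (((hasDerivAt_id x).const_mul β).const_add α |>.add this).congr_deriv (by simp)
  · rw [(hJ b.continuous).integral_eq]; ring

namespace IsSol

variable {V φ ψ φ' ψ' : ℝ → ℝ} {v₀ v₁ : ℝ}

theorem continuous (h : IsSol V φ ψ) : Continuous φ :=
  continuous_iff_continuousAt.2 fun x => (h.hasDerivAt x).continuousAt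

theorem continuous_deriv (h : IsSol V φ ψ) : Continuous ψ := h.isPrimitive.continuous

theorem isPrimitive_fun (h : IsSol V φ ψ) : IsPrimitive φ ψ :=
  .of_hasDerivAt h.hasDerivAt h.continuous_deriv

theorem deriv_eq (h : IsSol V φ ψ) : deriv φ = ψ := funext fun x => (h.hasDerivAt x).deriv

theorem sub (h : IsSol V φ ψ) (h' : IsSol V φ' ψ') :
    IsSol V (fun x => φ x - φ' x) (fun x => ψ x - ψ' x) :=
  ⟨fun x => (h.hasDerivAt x).sub (h'.hasDerivAt x), by
    simpa only [mul_sub] using h.isPrimitive.sub h'.isPrimitive⟩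

theorem const_mul (h : IsSol V φ ψ) (c : ℝ) :
    IsSol V (fun x => c * φ x) (fun x => c * ψ x) :=
  ⟨fun x => (h.hasDerivAt x).const_mul c, by
    simpa only [mul_left_comm c] using h.isPrimitive.const_mul c⟩

theorem comp_neg (h : IsSol V φ ψ) :
    IsSol (fun x => V (-x)) (fun x => φ (-x)) (fun x => -ψ (-x)) :=
  ⟨fun x => ((h.hasDerivAt (-x)).comp x (hasDerivAt_neg x)).congr_deriv (by simp), by
    simpa using h.isPrimitive.comp_neg.neg⟩

theorem wronskian (h : IsSol V φ ψ) (h' : IsSol V φ' ψ') (x y : ℝ) :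
    φ x * ψ' x - ψ x * φ' x = φ y * ψ' y - ψ y * φ' y :=
  ((h.isPrimitive_fun.mul h'.isPrimitive).sub (h.isPrimitive.mul h'.isPrimitive_fun)).congr_fun
    (ae_of_all _ fun t => by ring)

/-- The solution of the initial value problem is unique. -/
theorem eq_zero (hV : IsPotential V v₀ v₁) (h : IsSol V φ ψ) {a : ℝ} (h0 : φ a = 0)
    (h1 : ψ a = 0) (x : ℝ) : φ x = 0 := by
  -- The Wronskians of `φ` with `C` and with `S` vanish at `a`, hence everywhere; as `C S' - S C' =
  -- 1`, solving for `φ` gives `0`.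
  obtain ⟨C, C', hC, hC0, hC1⟩ := hV.exists_isSol 1 0
  obtain ⟨S, S', hS, hS0, hS1⟩ := hV.exists_isSol 0 1
  have e1 := h.wronskian hC x a
  have e2 := h.wronskian hS x a
  have e3 := hC.wronskian hS x 0
  simp only [h0, h1, hC0, hC1, hS0, hS1] at e1 e2 e3
  linear_combination (-φ x) * e3 + C x * e2 - S x * e1

/-- For `V ≥ 0` this derivative is nonnegative, so `φ φ'` is nondecreasing; this serves as the
maximum principle. -/
theorem isPrimitive_mul (h : IsSol V φ ψ) :
    IsPrimitive (fun x => φ x * ψ x) (fun x => ψ x ^ 2 + V x * φ x ^ 2) := by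
  convert h.isPrimitive_fun.mul h.isPrimitive using 2
  ring

theorem monotone_mul (hV : IsPotential V v₀ v₁) (h : IsSol V φ ψ) :
    Monotone fun x => φ x * ψ x :=
  h.isPrimitive_mul.monotone (by
    filter_upwards [hV.bound] with x hx
    have := hV.pos.le.trans hx.1
    positivity)

theorem hasDerivAt_sq (h : IsSol V φ ψ) (x : ℝ) :
    HasDerivAt (fun x => φ x ^ 2) (2 * (φ x * ψ x)) x :=
  ((h.hasDerivAt x).pow 2).congr_deriv (by simp; ring)

theorem monotoneOn_sq (hV : IsPotential V v₀ v₁) (h : IsSol V φ ψ) {a : ℝ}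
    (ha : 0 ≤ φ a * ψ a) : MonotoneOn (fun x => φ x ^ 2) (Ici a) := by
  refine monotoneOn_of_deriv_nonneg (convex_Ici a) (h.continuous.pow 2).continuousOn
    (fun x _ => (h.hasDerivAt_sq x).differentiableAt.differentiableWithinAt) fun x hx => ?_
  rw [interior_Ici] at hx
  rw [(h.hasDerivAt_sq x).deriv]
  have := h.monotone_mul hV (le_of_lt (mem_Ioi.1 hx))
  simp only at this
  linarith

/-- To the right of `a` the square `φ²` does not decrease, so `φ` cannot reach `0` and keeps its
sign. Applied to differences of solutions, this is the comparison principle. -/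
theorem le_of_nonneg_deriv (hV : IsPotential V v₀ v₁) (h : IsSol V φ ψ) {a : ℝ} (h0 : 0 < φ a)
    (h1 : 0 ≤ ψ a) {x : ℝ} (hx : a ≤ x) : φ a ≤ φ x := by
  have hmono := h.monotoneOn_sq hV (mul_nonneg h0.le h1)
  have hsq : ∀ y, a ≤ y → φ a ^ 2 ≤ φ y ^ 2 := fun y hy => hmono self_mem_Ici hy hy
  have hpos : 0 < φ x := by
    by_contra! hn
    obtain ⟨c, hc, hc0⟩ := intermediate_value_Icc' hx h.continuous.continuousOn ⟨hn, h0.le⟩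
    have := hsq c hc.1
    rw [hc0] at this
    nlinarith
  exact le_of_sq_le_sq (hsq x hx) hpos.le

end IsSol

/-! ### Existence and uniqueness of the decaying solutions. -/

/-- `φ > 0` is a nonincreasing solution of `φ'' = V φ` that tends to `0` at `+∞`. -/
structure IsDecaying (V φ ψ : ℝ → ℝ) : Prop extends IsSol V φ ψ where
  zero : φ 0 = 1
  pos : ∀ x, 0 < φ x
  nonpos : ∀ x, ψ x ≤ 0
  tendsto : Tendsto φ atTop (𝓝 0)

/-- The quotient `S/C` has derivative `1/C²`, so it increases strictly; once it is bounded, with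
limit `L`, the solution `C - S/L = C (1 - (S/C)/L)` is positive and negligible against `C`.
Comparison then yields monotonicity, and the equation yields decay. -/
theorem IsPotential.exists_isDecaying {V : ℝ → ℝ} {v₀ v₁ : ℝ} (hV : IsPotential V v₀ v₁) :
    ∃ φ ψ, IsDecaying V φ ψ := by
  obtain ⟨C, C', hC, hC0, hC1⟩ := hV.exists_isSol 1 0
  obtain ⟨S, S', hS, hS0, hS1⟩ := hV.exists_isSol 0 1
  have hCge : ∀ x, 1 ≤ C x := by
    intro x
    rcases le_total 0 x with hx | hx
    · simpa [hC0] using hC.le_of_nonneg_deriv hV (by simp [hC0]) hC1.ge hx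
    · simpa [hC0] using hC.comp_neg.le_of_nonneg_deriv hV.comp_neg (a := 0) (by simp [hC0])
        (by simp [hC1]) (neg_nonneg.2 hx)
  have hCpos : ∀ x, 0 < C x := fun x => one_pos.trans_le (hCge x)
  have hd : ∀ x, HasDerivAt (fun x => S x / C x) (1 / C x ^ 2) x := fun x => by
    refine ((hS.hasDerivAt x).div (hC.hasDerivAt x) (hCpos x).ne').congr_deriv ?_
    have := hC.wronskian hS x 0
    simp only [hC0, hC1, hS0, hS1] at this
    congr 1
    linear_combination this
  have hmono : StrictMono fun x => S x / C x :=
    strictMono_of_deriv_pos fun x => by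
      rw [(hd x).deriv]
      have := hCpos x
      positivity
  have hC'1 : 0 < C' 1 := by
    have h1 := ((hC.isPrimitive.sub (.of_hasDerivAt (f := fun x => v₀ * x) (f' := fun _ => v₀)
      (fun x => by simpa using (hasDerivAt_id x).const_mul v₀) continuous_const)).monotone (by
        filter_upwards [hV.bound] with x hx
        nlinarith [hCge x, hV.pos])) zero_le_one
    simp only [hC1] at h1
    linarith [hV.pos]
  obtain ⟨K, hK⟩ : ∃ K, ∀ x, S x / C x ≤ K := by
    -- With this `K` the solution `K C - S` has positive value and nonnegative slope at `1`, so it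
    -- stays positive beyond. The base point is `1` because `C'(0) = 0` leaves no control of the
    -- slope at `0`.
    refine ⟨max (S 1 + 1) (S' 1 / C' 1), fun x => ?_⟩
    set K := max (S 1 + 1) (S' 1 / C' 1)
    suffices h : ∀ x, 1 ≤ x → S x / C x ≤ K from
      (hmono.monotone (le_max_left x 1)).trans (h _ (le_max_right x 1))
    intro x hx
    rw [div_le_iff₀ (hCpos x), ← sub_nonneg]
    have hS1p : 0 < S 1 := by
      have := hmono zero_lt_one
      simp only [hS0, zero_div] at this
      exact (div_pos_iff_of_pos_right (hCpos 1)).1 this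
    have hK1 : S 1 + 1 ≤ K := le_max_left _ _
    have h0 : 0 < K * C 1 - S 1 := by nlinarith [hCge 1]
    have h1 : 0 ≤ K * C' 1 - S' 1 := by
      have := (div_le_iff₀ hC'1).1 (le_max_right (S 1 + 1) (S' 1 / C' 1))
      linarith
    exact h0.le.trans (((hC.const_mul K).sub hS).le_of_nonneg_deriv hV h0 h1 hx)
  have hbdd : BddAbove (range fun x => S x / C x) := ⟨K, by rintro _ ⟨x, rfl⟩; exact hK x⟩
  obtain ⟨L, hL⟩ : ∃ L, Tendsto (fun x => S x / C x) atTop (𝓝 L) :=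
    ⟨_, tendsto_atTop_ciSup hmono.monotone hbdd⟩
  have hlt : ∀ x, S x / C x < L := fun x =>
    (hmono (lt_add_one x)).trans_le (hmono.monotone.ge_of_tendsto hL _)
  have hLpos : 0 < L := by simpa [hS0] using hlt 0
  have hφ := hC.sub (hS.const_mul L⁻¹)
  have hq : ∀ x, (C x - L⁻¹ * S x) = C x * (1 - L⁻¹ * (S x / C x)) := fun x => by
    have := (hCpos x).ne'
    field_simp
  have hpos : ∀ x, 0 < C x - L⁻¹ * S x := fun x => by
    rw [hq]
    refine mul_pos (hCpos x) (sub_pos.2 ?_)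
    rw [inv_mul_lt_iff₀ hLpos, mul_one]
    exact hlt x
  have hlim : Tendsto (fun x => (C x - L⁻¹ * S x) / C x) atTop (𝓝 0) := by
    have : (fun x => (C x - L⁻¹ * S x) / C x) = fun x => 1 - L⁻¹ * (S x / C x) :=
      funext fun x => by rw [hq, mul_div_cancel_left₀ _ (hCpos x).ne']
    rw [this]
    simpa [hLpos.ne'] using (hL.const_mul L⁻¹).const_sub 1
  have hnonpos : ∀ x, C' x - L⁻¹ * S' x ≤ 0 := by
    intro a
    by_contra! hn
    -- If the slope were positive at `a`, subtracting a small `ε C` would keep value and slope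
    -- positive there, and comparison would give `φ/C ≥ ε` on `[a, ∞)`, against `φ/C → 0`.
    obtain ⟨ε, hε, h0, h1⟩ : ∃ ε > 0, ε * C a < C a - L⁻¹ * S a ∧
        ε * C' a < C' a - L⁻¹ * S' a := by
      have ht : ∀ c : ℝ, Tendsto (fun ε : ℝ => ε * c) (𝓝[>] 0) (𝓝 0) := fun c => by
        have : Tendsto (fun ε : ℝ => ε * c) (𝓝 0) (𝓝 (0 * c)) :=
          (continuous_id.mul continuous_const).tendsto 0
        rw [zero_mul] at this
        exact this.mono_left nhdsWithin_le_nhds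
      exact (((eventually_mem_nhdsWithin (a := (0 : ℝ)) (s := Ioi 0)).and
        (((ht _).eventually_lt_const (hpos a)).and ((ht _).eventually_lt_const hn)))).exists
    have hge : ∀ x, a ≤ x → ε ≤ (C x - L⁻¹ * S x) / C x := fun x hx => by
      have := (hφ.sub (hC.const_mul ε)).le_of_nonneg_deriv hV (sub_pos.2 h0) (sub_pos.2 h1).le hx
      rw [le_div_iff₀ (hCpos x)]
      linarith
    exact absurd (ge_of_tendsto hlim (eventually_atTop.2 ⟨a, hge⟩)) (not_le.2 hε)
  have hanti : Antitone fun x => C x - L⁻¹ * S x :=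
    antitone_of_deriv_nonpos (fun x => (hφ.hasDerivAt x).differentiableAt) fun x => by
      rw [(hφ.hasDerivAt x).deriv]; exact hnonpos x
  refine ⟨_, _, hφ, by simp [hC0, hS0], hpos, hnonpos, ?_⟩
  -- As `φ` is nonincreasing, `φ'(x) - φ'(0) = ∫ V φ ≥ v₀ x φ(x)`, with `φ'(x) ≤ 0` and `φ'(0) =
  -- -1/L`.
  have hbd : ∀ x, 0 < x → C x - L⁻¹ * S x ≤ L⁻¹ / v₀ * x⁻¹ := fun x hx => by
    have h1 := hφ.isPrimitive.integral_eq 0 x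
    have h2 : ∫ t in (0 : ℝ)..x, v₀ * (C x - L⁻¹ * S x) ≤
        ∫ t in (0 : ℝ)..x, V t * (C t - L⁻¹ * S t) := by
      refine intervalIntegral.integral_mono_ae_restrict hx.le (by simp)
        (hφ.isPrimitive.intervalIntegrable _ _) ?_
      rw [EventuallyLE, ae_restrict_iff' measurableSet_Icc]
      filter_upwards [hV.bound] with t ht htx
      exact mul_le_mul ht.1 (hanti htx.2) (hpos x).le (hV.pos.le.trans ht.1)
    rw [h1, intervalIntegral.integral_const, hC1, hS1] at h2
    have := hnonpos x
    have hv := hV.pos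
    rw [← div_eq_mul_inv, div_div, le_div_iff₀ (by positivity)]
    simp only [smul_eq_mul, sub_zero] at h2
    nlinarith
  refine tendsto_of_tendsto_of_tendsto_of_le_of_le' tendsto_const_nhds
    (by simpa using tendsto_inv_atTop_zero.const_mul (L⁻¹ / v₀))
    (Eventually.of_forall fun x => (hpos x).le) ?_
  filter_upwards [eventually_gt_atTop 0] with x hx using hbd x hx

/-- A solution vanishing at `0` and tending to `0` at `+∞` vanishes identically. -/
theorem IsSol.eq_zero_of_tendsto {V φ ψ : ℝ → ℝ} {v₀ v₁ : ℝ} (hV : IsPotential V v₀ v₁)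
    (h : IsSol V φ ψ) (h0 : φ 0 = 0) (hl : Tendsto φ atTop (𝓝 0)) (x : ℝ) : φ x = 0 := by
  have hlsq : Tendsto (fun x => φ x ^ 2) atTop (𝓝 0) := by simpa using hl.pow 2
  -- A positive value of `φ φ'` would make `φ²` nondecreasing from there on, which is incompatible
  -- with the limit `0` unless `φ(a) = 0`.
  have hle : ∀ a, φ a * ψ a ≤ 0 := fun a => by
    by_contra! hn
    have hmono := h.monotoneOn_sq hV hn.le
    have : φ a ^ 2 ≤ 0 := ge_of_tendsto hlsq (eventually_atTop.2 ⟨a, fun x hx =>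
      hmono self_mem_Ici hx hx⟩)
    have : φ a = 0 := by nlinarith [sq_nonneg (φ a)]
    simp [this] at hn
  have hanti : Antitone fun x => φ x ^ 2 :=
    antitone_of_deriv_nonpos (fun x => (h.hasDerivAt_sq x).differentiableAt) fun x => by
      rw [(h.hasDerivAt_sq x).deriv]; linarith [hle x]
  have hz : ∀ x, 0 ≤ x → φ x = 0 := fun x hx => by
    have := hanti hx
    simp only [h0] at this
    nlinarith [sq_nonneg (φ x)]
  -- At `1`, unlike at `0`, `φ` is known to vanish on a full neighbourhood, so its derivative
  -- vanishes as well.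
  refine h.eq_zero hV (hz 1 zero_le_one) ?_ x
  have h1 : φ =ᶠ[𝓝 1] fun _ => 0 := by
    filter_upwards [lt_mem_nhds (zero_lt_one (α := ℝ))] with x hx using hz x hx.le
  exact (h.hasDerivAt 1).unique ((hasDerivAt_const 1 (0 : ℝ)).congr_of_eventuallyEq h1)

/-- The weak derivative `φ₁` is fixed only a.e.; its absolutely continuous representative is the
classical derivative. -/
theorem IsDecayingSolution.exists_isSol {V φ : ℝ → ℝ} {l : Filter ℝ}
    (h : IsDecayingSolution V l φ) : ∃ ψ, IsSol V φ ψ := by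
  obtain ⟨⟨φ₁, φ₂, h2, hae⟩, -, -⟩ := h
  obtain ⟨ψ, hψ, he⟩ := h2.weakDeriv₂.exists_isPrimitive
  exact ⟨ψ, ((h2.weakDeriv.isPrimitive h2.continuous).congr_ae he).hasDerivAt hψ.continuous,
    hψ.congr_ae hae⟩

theorem IsSol.isDecayingSolution {V φ ψ : ℝ → ℝ} {v₀ v₁ : ℝ} (hV : IsPotential V v₀ v₁)
    (h : IsSol V φ ψ) {l : Filter ℝ} (h0 : φ 0 = 1) (hl : Tendsto φ l (𝓝 0)) :
    IsDecayingSolution V l φ :=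
  ⟨⟨ψ, _, ⟨h.continuous, h.isPrimitive_fun.hasWeakDeriv, h.isPrimitive.hasWeakDeriv,
    h.continuous.isLInftyLoc, h.continuous_deriv.isLInftyLoc, fun K hK =>
      MemLp.mul' (p := ∞) (q := ∞) (h.continuous.isLInftyLoc K hK) (hV.isLInftyLoc K hK)⟩,
    ae_of_all _ fun _ => rfl⟩, h0, hl⟩

theorem IsDecayingSolution.comp_neg {V φ : ℝ → ℝ} {v₀ v₁ : ℝ} (hV : IsPotential V v₀ v₁)
    {l l' : Filter ℝ} (hl : Tendsto (fun x => -x) l' l) (h : IsDecayingSolution V l φ) :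
    IsDecayingSolution (fun x => V (-x)) l' (fun x => φ (-x)) := by
  obtain ⟨ψ, hψ⟩ := h.exists_isSol
  exact hψ.comp_neg.isDecayingSolution hV.comp_neg (by simpa using h.2.1) (h.2.2.comp hl)

theorem IsDecayingSolution.unique {V φ φ' : ℝ → ℝ} {v₀ v₁ : ℝ} (hV : IsPotential V v₀ v₁)
    (h : IsDecayingSolution V atTop φ) (h' : IsDecayingSolution V atTop φ') : φ = φ' := by
  obtain ⟨ψ, hψ⟩ := h.exists_isSol
  obtain ⟨ψ', hψ'⟩ := h'.exists_isSol
  funext x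
  exact sub_eq_zero.1 ((hψ.sub hψ').eq_zero_of_tendsto hV (by simp [h.2.1, h'.2.1])
    (by simpa using h.2.2.sub h'.2.2) x)

theorem IsDecayingSolution.existsUnique {V : ℝ → ℝ} {v₀ v₁ : ℝ} (hV : IsPotential V v₀ v₁) :
    ∃! φ, IsDecayingSolution V atTop φ := by
  obtain ⟨φ, ψ, h⟩ := hV.exists_isDecaying
  exact ⟨φ, h.isDecayingSolution hV h.zero h.tendsto, fun φ' h' =>
    h'.unique hV (h.isDecayingSolution hV h.zero h.tendsto)⟩

theorem IsDecayingSolution.existsUnique_atBot {V : ℝ → ℝ} {v₀ v₁ : ℝ}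
    (hV : IsPotential V v₀ v₁) : ∃! φ, IsDecayingSolution V atBot φ := by
  obtain ⟨φ, h, hu⟩ := IsDecayingSolution.existsUnique hV.comp_neg
  refine ⟨fun x => φ (-x), by simpa using h.comp_neg hV.comp_neg tendsto_neg_atBot_atTop,
    fun φ' h' => funext fun x => ?_⟩
  have := congrFun (hu _ (h'.comp_neg hV tendsto_neg_atTop_atBot)) (-x)
  simpa using this

theorem IsDecayingSolution.exists_isDecaying {V φ : ℝ → ℝ} {v₀ v₁ : ℝ}
    (hV : IsPotential V v₀ v₁) (h : IsDecayingSolution V atTop φ) : ∃ ψ, IsDecaying V φ ψ := by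
  obtain ⟨φ', ψ', h'⟩ := hV.exists_isDecaying
  obtain rfl := h.unique hV (h'.isDecayingSolution hV h'.zero h'.tendsto)
  exact ⟨ψ', h'⟩

/-! ### Bounds and integrability for the decaying solution. -/

namespace IsDecaying

variable {V φ ψ : ℝ → ℝ} {v₀ v₁ : ℝ}

theorem antitone (h : IsDecaying V φ ψ) : Antitone φ :=
  antitone_of_deriv_nonpos (fun x => (h.hasDerivAt x).differentiableAt) fun x => by
    rw [(h.hasDerivAt x).deriv]; exact h.nonpos x

/-- Since `φ'` is nondecreasing, it is squeezed between its mean `φ(x) - φ(x - 1)` over `[x - 1, x]`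
and `0`. -/
theorem deriv_tendsto (hV : IsPotential V v₀ v₁) (h : IsDecaying V φ ψ) :
    Tendsto ψ atTop (𝓝 0) := by
  have hψ : Monotone ψ := h.isPrimitive.monotone (by
    filter_upwards [hV.bound] with x hx using mul_nonneg (hV.pos.le.trans hx.1) (h.pos x).le)
  have hlow : ∀ x, φ x - φ (x - 1) ≤ ψ x := fun x => by
    rw [← h.isPrimitive_fun.integral_eq]
    calc ∫ t in (x - 1)..x, ψ t ≤ ∫ t in (x - 1)..x, ψ x :=
          intervalIntegral.integral_mono_on (by linarith)
            (h.continuous_deriv.intervalIntegrable _ _) (by simp) fun t ht => hψ ht.2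
      _ = ψ x := by simp
  refine tendsto_of_tendsto_of_tendsto_of_le_of_le ?_ tendsto_const_nhds hlow h.nonpos
  simpa [sub_eq_add_neg] using h.tendsto.sub
    (h.tendsto.comp (tendsto_atTop_add_const_right atTop (-1) tendsto_id))

/-- The derivative of `φ'² - v₁ φ²` is `2 φ φ' (V - v₁) ≥ 0`, and the limit at `+∞` is `0`. -/
theorem sq_deriv_le (hV : IsPotential V v₀ v₁) (h : IsDecaying V φ ψ) (x : ℝ) :
    ψ x ^ 2 ≤ v₁ * φ x ^ 2 := by
  have hm : Monotone fun x => ψ x * ψ x - v₁ * (φ x * φ x) :=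
    ((h.isPrimitive.mul h.isPrimitive).sub
      ((h.isPrimitive_fun.mul h.isPrimitive_fun).const_mul v₁)).monotone (by
        filter_upwards [hV.bound] with x hx
        nlinarith [mul_nonneg (mul_nonneg (neg_nonneg.2 (h.nonpos x)) (h.pos x).le)
          (sub_nonneg.2 hx.2)])
  have hl : Tendsto (fun x => ψ x * ψ x - v₁ * (φ x * φ x)) atTop (𝓝 0) := by
    simpa using ((h.deriv_tendsto hV).mul (h.deriv_tendsto hV)).sub
      ((h.tendsto.mul h.tendsto).const_mul v₁)
  have := hm.ge_of_tendsto hl x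
  nlinarith

theorem abs_div_le (hV : IsPotential V v₀ v₁) (h : IsDecaying V φ ψ) (x : ℝ) :
    |ψ x / φ x| ≤ √v₁ := by
  refine Real.abs_le_sqrt ?_
  rw [div_pow, div_le_iff₀ (pow_pos (h.pos x) 2)]
  exact h.sq_deriv_le hV x

/-- The integral of `φ'² + V φ²` over `[a, b]` is the increment of `φ φ' ≤ 0`, hence at most `-φ(a)
φ'(a)`; and `V ≥ v₀ > 0`. -/
theorem integrableOn_sq (hV : IsPotential V v₀ v₁) (h : IsDecaying V φ ψ) (a : ℝ) :
    IntegrableOn (fun x => φ x ^ 2) (Ioi a) ∧ IntegrableOn (fun x => ψ x ^ 2) (Ioi a) := by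
  have hnn : ∀ᵐ x, 0 ≤ V x * φ x ^ 2 ∧ v₀ * φ x ^ 2 ≤ V x * φ x ^ 2 := by
    filter_upwards [hV.bound] with x hx
    have := hV.pos.le.trans hx.1
    exact ⟨by positivity, mul_le_mul_of_nonneg_right hx.1 (sq_nonneg _)⟩
  have hp := h.isPrimitive_mul
  have hI : IntegrableOn (fun x => ψ x ^ 2 + V x * φ x ^ 2) (Ioi a) := by
    refine integrableOn_Ioi_of_intervalIntegral_norm_bounded (-(φ a * ψ a)) a
      (fun b => ((hp.locInt.integrableOn_isCompact (isCompact_Icc (a := a) (b := b))).mono_set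
        Ioc_subset_Icc_self)) tendsto_id (Eventually.of_forall fun b => ?_)
    have : ∫ x in a..b, ‖ψ x ^ 2 + V x * φ x ^ 2‖ = φ b * ψ b - φ a * ψ a := by
      rw [← hp.integral_eq]
      refine intervalIntegral.integral_congr_ae ?_
      filter_upwards [hnn] with x hx _
      exact Real.norm_of_nonneg (add_nonneg (sq_nonneg _) hx.1)
    refine this.trans_le ?_
    linarith [mul_nonneg (h.pos b).le (neg_nonneg.2 (h.nonpos b))]
  constructor
  · refine (hI.const_mul v₀⁻¹).mono' (h.continuous.pow 2).aestronglyMeasurable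
      (ae_restrict_of_ae ?_)
    filter_upwards [hnn] with x hx
    rw [Real.norm_of_nonneg (sq_nonneg _), ← div_eq_inv_mul, le_div_iff₀ hV.pos]
    nlinarith [sq_nonneg (ψ x)]
  · refine hI.mono' (h.continuous_deriv.pow 2).aestronglyMeasurable (ae_restrict_of_ae ?_)
    filter_upwards [hnn] with x hx
    rw [Real.norm_of_nonneg (sq_nonneg _)]
    linarith

end IsDecaying

namespace IsPrimitive

variable {f f' : ℝ → ℝ}

theorem integrableOn_Iic_of_nonneg (hf : IsPrimitive f f') (h0 : ∀ x, 0 ≤ f' x) {l : ℝ}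
    (hl : Tendsto f atBot (𝓝 l)) (a : ℝ) : IntegrableOn f' (Iic a) := by
  refine integrableOn_Iic_of_intervalIntegral_norm_tendsto (f a - l) a
    (fun b => (hf.locInt.integrableOn_isCompact (isCompact_Icc (a := b) (b := a))).mono_set
      Ioc_subset_Icc_self) tendsto_id ?_
  have h : ∀ b, ∫ x in b..a, ‖f' x‖ = f a - f b := fun b => by
    simp only [Real.norm_of_nonneg (h0 _), hf.integral_eq]
  simp only [h]
  exact hl.const_sub _

theorem integrableOn_Ici_of_nonneg (hf : IsPrimitive f f') (h0 : ∀ x, 0 ≤ f' x) {l : ℝ}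
    (hl : Tendsto f atTop (𝓝 l)) (a : ℝ) : IntegrableOn f' (Ici a) := by
  have := (hf.comp_neg.neg.integrableOn_Iic_of_nonneg (fun x => by simpa using h0 (-x))
    (hl.comp tendsto_neg_atBot_atTop).neg (-a)).comp_neg
  simpa using this

end IsPrimitive

/-! ### Riccati equation and completion of the square. -/

/-- The solutions of `φ'' = V φ` decaying at `+∞` and at `-∞`, with their derivatives. -/
structure IsDecayingPair (V : ℝ → ℝ) (c : ℝ) (φp ψp φm ψm : ℝ → ℝ) : Prop where
  solp : IsSol V φp ψp
  solm : IsSol V φm ψm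
  zerop : φp 0 = 1
  zerom : φm 0 = 1
  posp : ∀ x, 0 < φp x
  posm : ∀ x, 0 < φm x
  nonpos : ∀ x, ψp x ≤ 0
  nonneg : ∀ x, 0 ≤ ψm x
  tendsto_p : Tendsto φp atTop (𝓝 0)
  tendsto_m : Tendsto φm atBot (𝓝 0)
  abs_div_le_p : ∀ x, |ψp x / φp x| ≤ c
  abs_div_le_m : ∀ x, |ψm x / φm x| ≤ c
  integrable_p : ∀ a, IntegrableOn (fun x => φp x ^ 2) (Ioi a)
  integrable_p' : ∀ a, IntegrableOn (fun x => ψp x ^ 2) (Ioi a)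
  integrable_m : ∀ a, IntegrableOn (fun x => φm x ^ 2) (Iic a)
  integrable_m' : ∀ a, IntegrableOn (fun x => ψm x ^ 2) (Iic a)

theorem IsDecayingSolution.exists_pair {V φp φm : ℝ → ℝ} {v₀ v₁ : ℝ}
    (hV : IsPotential V v₀ v₁) (hp : IsDecayingSolution V atTop φp)
    (hm : IsDecayingSolution V atBot φm) : ∃ ψp ψm, IsDecayingPair V (√v₁) φp ψp φm ψm := by
  obtain ⟨ψp, h⟩ := hp.exists_isDecaying hV
  obtain ⟨ψ, h'⟩ := (hm.comp_neg hV tendsto_neg_atTop_atBot).exists_isDecaying hV.comp_neg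
  have hs := h'.toIsSol.comp_neg
  simp only [neg_neg] at hs
  refine ⟨ψp, fun x => -ψ (-x), h.toIsSol, hs, h.zero, by simpa using h'.zero, h.pos,
    fun x => by simpa using h'.pos (-x), h.nonpos, fun x => neg_nonneg.2 (h'.nonpos _), h.tendsto,
    hm.2.2, h.abs_div_le hV, fun x => ?_, fun a => (h.integrableOn_sq hV a).1,
    fun a => (h.integrableOn_sq hV a).2, fun a => ?_, fun a => ?_⟩
  · simpa [neg_div] using h'.abs_div_le hV.comp_neg (-x)
  · rw [integrableOn_Iic_iff_integrableOn_Iio]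
    simpa using (h'.integrableOn_sq hV.comp_neg (-a)).1.comp_neg
  · rw [integrableOn_Iic_iff_integrableOn_Iio]
    simpa using (h'.integrableOn_sq hV.comp_neg (-a)).2.comp_neg

namespace IsSol

variable {V φ ψ w w₁ : ℝ → ℝ} {v₀ v₁ : ℝ}

theorem isPrimitive_inv (h : IsSol V φ ψ) (h0 : ∀ x, 0 < φ x) :
    IsPrimitive (fun x => (φ x)⁻¹) (fun x => -ψ x / φ x ^ 2) :=
  .of_hasDerivAt (fun x => (h.hasDerivAt x).inv (h0 x).ne')
    (h.continuous_deriv.neg.div (h.continuous.pow 2) fun x => (pow_pos (h0 x) 2).ne')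

/-- The Riccati equation for the logarithmic derivative of a positive solution. -/
theorem isPrimitive_div (h : IsSol V φ ψ) (h0 : ∀ x, 0 < φ x) :
    IsPrimitive (fun x => ψ x / φ x) (fun x => V x - (ψ x / φ x) ^ 2) := by
  convert h.isPrimitive.mul (h.isPrimitive_inv h0) using 2 with x x
  · exact div_eq_mul_inv _ _
  · have := (h0 x).ne'
    field_simp
    ring

theorem hasDerivAt_log (h : IsSol V φ ψ) (h0 : ∀ x, 0 < φ x) (x : ℝ) :
    HasDerivAt (logFun φ) (ψ x / φ x) x := (h.hasDerivAt x).log (h0 x).ne'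

/-- Completion of the square: by Riccati, `(r w²)' = (V - r²) w² + 2 r w w'`. -/
theorem isPrimitive_div_mul_sq (h : IsSol V φ ψ) (h0 : ∀ x, 0 < φ x) (hw : IsPrimitive w w₁) :
    IsPrimitive (fun x => ψ x / φ x * (w x * w x))
      (fun x => (w₁ x ^ 2 + V x * w x ^ 2) - (w₁ x - ψ x / φ x * w x) ^ 2) := by
  convert (h.isPrimitive_div h0).mul (hw.mul hw) using 2 with x
  ring

end IsSol

theorem IsH1.isPrimitive {w w₁ : ℝ → ℝ} (h : IsH1 w w₁) : IsPrimitive w w₁ :=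
  h.weakDeriv.isPrimitive h.continuous

theorem IsH1.integrable_energy {V w w₁ : ℝ → ℝ} {v₀ v₁ : ℝ} (hV : IsPotential V v₀ v₁)
    (h : IsH1 w w₁) : Integrable (fun x => w₁ x ^ 2 + V x * w x ^ 2) :=
  h.memLp₁.integrable_sq.add (h.memLp.integrable_sq.bdd_mul hV.aesm hV.ae_abs_le)

theorem IsH1.tendsto_sq {w w₁ : ℝ → ℝ} (h : IsH1 w w₁) :
    Tendsto (fun x => w x * w x) atTop (𝓝 0) ∧ Tendsto (fun x => w x * w x) atBot (𝓝 0) := by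
  have hp := h.isPrimitive.mul h.isPrimitive
  have hi := h.memLp.integrable_mul h.memLp
  have hi' := (h.memLp₁.integrable_mul h.memLp).add (h.memLp.integrable_mul h.memLp₁)
  exact ⟨hp.tendsto_zero hi hi', hp.tendsto_zero_atBot hi hi'⟩

namespace IsSol

variable {V φ ψ w w₁ : ℝ → ℝ} {v₀ v₁ c : ℝ}

theorem continuous_div (h : IsSol V φ ψ) (h0 : ∀ x, 0 < φ x) :
    Continuous fun x => ψ x / φ x :=
  h.continuous_deriv.div h.continuous fun x => (h0 x).ne'

theorem integrable_sub_sq (h : IsSol V φ ψ) (h0 : ∀ x, 0 < φ x)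
    (hc : ∀ x, |ψ x / φ x| ≤ c) (hw : IsH1 w w₁) :
    Integrable (fun x => (w₁ x - ψ x / φ x * w x) ^ 2) := by
  have h1 : MemLp (fun x => ψ x / φ x * w x) 2 volume :=
    hw.memLp.mul' (p := ∞) (q := 2)
      (memLp_top_of_bound (h.continuous_div h0).aestronglyMeasurable c (ae_of_all _ hc))
  exact (hw.memLp₁.sub h1).integrable_sq

theorem tendsto_div_mul_sq {l : Filter ℝ} (hc : ∀ x, |ψ x / φ x| ≤ c)
    (hl : Tendsto (fun x => w x * w x) l (𝓝 0)) :
    Tendsto (fun x => ψ x / φ x * (w x * w x)) l (𝓝 0) :=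
  bdd_le_mul_tendsto_zero' c (Eventually.of_forall hc) hl

theorem energy_Ioi (hV : IsPotential V v₀ v₁) (h : IsSol V φ ψ) (h0 : ∀ x, 0 < φ x)
    (hc : ∀ x, |ψ x / φ x| ≤ c) (hw : IsH1 w w₁) (a : ℝ) :
    ∫ x in Ioi a, (w₁ x ^ 2 + V x * w x ^ 2) =
      (∫ x in Ioi a, (w₁ x - ψ x / φ x * w x) ^ 2) - ψ a / φ a * w a ^ 2 := by
  have h1 := (hw.integrable_energy hV).integrableOn (s := Ioi a)
  have h2 := (h.integrable_sub_sq h0 hc hw).integrableOn (s := Ioi a)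
  have h3 := (h.isPrimitive_div_mul_sq h0 hw.isPrimitive).integral_Ioi (h1.sub h2)
    (tendsto_div_mul_sq hc hw.tendsto_sq.1)
  rw [integral_sub h1 h2] at h3
  linear_combination h3

theorem energy_Iic (hV : IsPotential V v₀ v₁) (h : IsSol V φ ψ) (h0 : ∀ x, 0 < φ x)
    (hc : ∀ x, |ψ x / φ x| ≤ c) (hw : IsH1 w w₁) (a : ℝ) :
    ∫ x in Iic a, (w₁ x ^ 2 + V x * w x ^ 2) =
      (∫ x in Iic a, (w₁ x - ψ x / φ x * w x) ^ 2) + ψ a / φ a * w a ^ 2 := by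
  have h1 := (hw.integrable_energy hV).integrableOn (s := Iic a)
  have h2 := (h.integrable_sub_sq h0 hc hw).integrableOn (s := Iic a)
  have h3 := (h.isPrimitive_div_mul_sq h0 hw.isPrimitive).integral_Iic (h1.sub h2)
    (tendsto_div_mul_sq hc hw.tendsto_sq.2)
  rw [integral_sub h1 h2] at h3
  linear_combination h3

/-- For the equality case: where `w' = r w`, the quotient `w/φ` is constant. -/
theorem isPrimitive_quotient (h : IsSol V φ ψ) (h0 : ∀ x, 0 < φ x) (hw : IsPrimitive w w₁) :
    IsPrimitive (fun x => w x / φ x) (fun x => (w₁ x - ψ x / φ x * w x) / φ x) := by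
  convert hw.mul (h.isPrimitive_inv h0) using 2 with x
  have := (h0 x).ne'
  field_simp
  ring

end IsSol

/-! ### The peak function as the unique minimizer. -/

/-- The function with value `1` at `a` that is a multiple of `φm` to the left and of `φp` to the
right of `a`. -/
noncomputable def peak (φp φm : ℝ → ℝ) (a x : ℝ) : ℝ :=
  if x ≤ a then φm x / φm a else φp x / φp a

/-- The weak derivative of `peak`. -/
noncomputable def peakDeriv (φp φm ψp ψm : ℝ → ℝ) (a x : ℝ) : ℝ :=
  if x ≤ a then ψm x / φm a else ψp x / φp a

namespace IsDecayingPair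

variable {V φp ψp φm ψm w w₁ : ℝ → ℝ} {v₀ v₁ c : ℝ}

theorem peak_of_le {a x : ℝ} (hx : x ≤ a) : peak φp φm a x = φm x / φm a := if_pos hx

theorem peak_of_ge (h : IsDecayingPair V c φp ψp φm ψm) {a x : ℝ} (hx : a ≤ x) :
    peak φp φm a x = φp x / φp a := by
  rcases hx.eq_or_lt with rfl | hx
  · rw [peak_of_le le_rfl, div_self (h.posm _).ne', div_self (h.posp _).ne']
  · exact if_neg (not_le.2 hx)

theorem peak_self (h : IsDecayingPair V c φp ψp φm ψm) (a : ℝ) : peak φp φm a a = 1 := by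
  rw [peak_of_le le_rfl, div_self (h.posm _).ne']

theorem peak_nonneg (h : IsDecayingPair V c φp ψp φm ψm) (a x : ℝ) : 0 ≤ peak φp φm a x := by
  unfold peak
  split_ifs
  · exact (div_pos (h.posm x) (h.posm a)).le
  · exact (div_pos (h.posp x) (h.posp a)).le

theorem antitone (h : IsDecayingPair V c φp ψp φm ψm) : Antitone φp :=
  antitone_of_deriv_nonpos (fun x => (h.solp.hasDerivAt x).differentiableAt) fun x => by
    rw [(h.solp.hasDerivAt x).deriv]; exact h.nonpos x

theorem monotone (h : IsDecayingPair V c φp ψp φm ψm) : Monotone φm :=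
  monotone_of_deriv_nonneg (fun x => (h.solm.hasDerivAt x).differentiableAt) fun x => by
    rw [(h.solm.hasDerivAt x).deriv]; exact h.nonneg x

theorem peak_le_one (h : IsDecayingPair V c φp ψp φm ψm) (a x : ℝ) : peak φp φm a x ≤ 1 := by
  rcases le_total x a with hx | hx
  · rw [peak_of_le hx, div_le_one (h.posm a)]
    exact h.monotone hx
  · rw [h.peak_of_ge hx, div_le_one (h.posp a)]
    exact h.antitone hx

theorem isPrimitive_peak (h : IsDecayingPair V c φp ψp φm ψm) (a : ℝ) :
    IsPrimitive (peak φp φm a) (peakDeriv φp φm ψp ψm a) := by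
  have hm := h.solm.isPrimitive_fun.const_mul (φm a)⁻¹
  have hp := h.solp.isPrimitive_fun.const_mul (φp a)⁻¹
  have hloc : LocallyIntegrable (peakDeriv φp φm ψp ψm a) volume := by
    rw [locallyIntegrable_iff]
    intro K hK
    have h1 := (hm.locInt.integrableOn_isCompact hK)
    have h2 := (hp.locInt.integrableOn_isCompact hK)
    refine (Integrable.piecewise (s := Iic a) measurableSet_Iic h1.integrableOn
      h2.integrableOn).congr (ae_of_all _ fun x => ?_)
    simp only [piecewise, mem_Iic, peakDeriv, div_eq_inv_mul]
  refine .of_integral_from hloc a fun x => ?_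
  rw [h.peak_self]
  rcases le_total x a with hx | hx
  · rw [peak_of_le hx]
    have := hm.integral_eq a x
    rw [inv_mul_cancel₀ (h.posm a).ne', ← div_eq_inv_mul] at this
    rw [← this]
    refine intervalIntegral.integral_congr_ae (ae_of_all _ fun t ht => ?_)
    rw [uIoc_of_ge hx] at ht
    rw [peakDeriv, if_pos ht.2, div_eq_inv_mul]
  · rw [h.peak_of_ge hx]
    have := hp.integral_eq a x
    rw [inv_mul_cancel₀ (h.posp a).ne', ← div_eq_inv_mul] at this
    rw [← this]
    refine intervalIntegral.integral_congr_ae (ae_of_all _ fun t ht => ?_)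
    rw [uIoc_of_le hx] at ht
    rw [peakDeriv, if_neg (not_le.2 ht.1), div_eq_inv_mul]

theorem memLp_glue {f g : ℝ → ℝ} {a : ℝ} (hf : Continuous f) (hg : Continuous g)
    (hfi : IntegrableOn (fun x => f x ^ 2) (Iic a))
    (hgi : IntegrableOn (fun x => g x ^ 2) (Ioi a)) (s t : ℝ) :
    MemLp (fun x => if x ≤ a then f x / s else g x / t) 2 volume := by
  have hm : Measurable fun x => if x ≤ a then f x / s else g x / t :=
    Measurable.ite measurableSet_Iic (hf.div_const s).measurable (hg.div_const t).measurable
  rw [memLp_two_iff_integrable_sq hm.aestronglyMeasurable]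
  refine (Integrable.piecewise (s := Iic a) measurableSet_Iic (hfi.div_const (s ^ 2))
    (g := fun x => g x ^ 2 / t ^ 2) (by rw [compl_Iic]; exact hgi.div_const (t ^ 2))).congr
    (ae_of_all _ fun x => ?_)
  simp only [piecewise, mem_Iic]
  split_ifs <;> rw [div_pow]

theorem isInK_peak (h : IsDecayingPair V c φp ψp φm ψm) (a : ℝ) :
    IsInK a (peak φp φm a) (peakDeriv φp φm ψp ψm a) := by
  have hprim := h.isPrimitive_peak a
  refine ⟨⟨hprim.continuous, memLp_glue h.solm.continuous h.solp.continuous (h.integrable_m a)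
    (h.integrable_p a) _ _, memLp_glue h.solm.continuous_deriv h.solp.continuous_deriv
    (h.integrable_m' a) (h.integrable_p' a) _ _, hprim.hasWeakDeriv⟩, h.peak_self a,
    le_antisymm ?_ ?_⟩
  · rw [eLpNorm_exponent_top]
    refine (eLpNormEssSup_le_of_ae_bound (C := 1) (ae_of_all _ fun x => ?_)).trans (by simp)
    rw [Real.norm_of_nonneg (h.peak_nonneg a x)]
    exact h.peak_le_one a x
  · rw [eLpNorm_exponent_top]
    -- The set where `|peak|` is at most its essential supremum is closed and of full measure, hence
    -- dense, hence contains `a`, where the value is `1`.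
    by_contra! hlt
    have hae := enorm_ae_le_eLpNormEssSup (peak φp φm a) volume
    have hcl : IsClosed {x | ‖peak φp φm a x‖ₑ ≤ eLpNormEssSup (peak φp φm a) volume} :=
      isClosed_le hprim.continuous.enorm continuous_const
    have hd : Dense {x | ‖peak φp φm a x‖ₑ ≤ eLpNormEssSup (peak φp φm a) volume} :=
      Measure.dense_of_ae hae
    have : a ∈ {x | ‖peak φp φm a x‖ₑ ≤ eLpNormEssSup (peak φp φm a) volume} := by
      rw [← hcl.closure_eq, hd.closure_eq]; trivial
    rw [mem_ofPred_eq, h.peak_self, enorm_one] at this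
    exact absurd hlt (not_lt.2 this)

theorem energy_eq (hV : IsPotential V v₀ v₁) (h : IsDecayingPair V c φp ψp φm ψm)
    (hw : IsH1 w w₁) (a : ℝ) :
    energyV V w w₁ = (∫ x in Iic a, (w₁ x - ψm x / φm x * w x) ^ 2) +
      (∫ x in Ioi a, (w₁ x - ψp x / φp x * w x) ^ 2) + (ψm a / φm a - ψp a / φp a) * w a ^ 2 := by
  rw [energyV, ← intervalIntegral.integral_Iic_add_Ioi (hw.integrable_energy hV).integrableOn
    (hw.integrable_energy hV).integrableOn, h.solm.energy_Iic hV h.posm h.abs_div_le_m hw,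
    h.solp.energy_Ioi hV h.posp h.abs_div_le_p hw]
  ring

theorem energy_peak (hV : IsPotential V v₀ v₁) (h : IsDecayingPair V c φp ψp φm ψm) (a : ℝ) :
    energyV V (peak φp φm a) (peakDeriv φp φm ψp ψm a) = ψm a / φm a - ψp a / φp a := by
  rw [h.energy_eq hV (h.isInK_peak a).isH1 a, h.peak_self,
    setIntegral_eq_zero_of_forall_eq_zero, setIntegral_eq_zero_of_forall_eq_zero]
  · ring
  · intro x hx
    have := (h.posp x).ne'
    rw [h.peak_of_ge (le_of_lt hx), peakDeriv, if_neg (not_le.2 hx)]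
    field_simp
    ring
  · intro x hx
    have := (h.posm x).ne'
    rw [peak_of_le hx, peakDeriv, if_pos (mem_Iic.1 hx)]
    field_simp
    ring

theorem energy_peak_le (hV : IsPotential V v₀ v₁) (h : IsDecayingPair V c φp ψp φm ψm) {a : ℝ}
    (hw : IsInK a w w₁) :
    energyV V (peak φp φm a) (peakDeriv φp φm ψp ψm a) ≤ energyV V w w₁ := by
  rw [h.energy_peak hV, h.energy_eq hV hw.isH1 a, hw.value]
  have h1 : 0 ≤ ∫ x in Iic a, (w₁ x - ψm x / φm x * w x) ^ 2 :=
    integral_nonneg fun x => sq_nonneg _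
  have h2 : 0 ≤ ∫ x in Ioi a, (w₁ x - ψp x / φp x * w x) ^ 2 :=
    integral_nonneg fun x => sq_nonneg _
  linarith

theorem isMinimizerK_peak (hV : IsPotential V v₀ v₁) (h : IsDecayingPair V c φp ψp φm ψm)
    (a : ℝ) : IsMinimizerK V a (peak φp φm a) :=
  ⟨_, h.isInK_peak a, fun _ _ hw => h.energy_peak_le hV hw⟩

/-- Minimality makes both integrals of squares vanish, so `w/φ₋` and `w/φ₊` are constant on their
half-lines, with constants fixed by `w(a) = 1`. -/
theorem eq_peak (hV : IsPotential V v₀ v₁) (h : IsDecayingPair V c φp ψp φm ψm) {a : ℝ}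
    (hw : IsMinimizerK V a w) : w = peak φp φm a := by
  obtain ⟨w₁, hw, hle⟩ := hw
  have he := hle _ _ (h.isInK_peak a)
  rw [h.energy_peak hV, h.energy_eq hV hw.isH1 a, hw.value] at he
  have h1 : 0 ≤ ∫ x in Iic a, (w₁ x - ψm x / φm x * w x) ^ 2 :=
    integral_nonneg fun x => sq_nonneg _
  have h2 : 0 ≤ ∫ x in Ioi a, (w₁ x - ψp x / φp x * w x) ^ 2 :=
    integral_nonneg fun x => sq_nonneg _
  have h1' : ∫ x in Iic a, (w₁ x - ψm x / φm x * w x) ^ 2 = 0 := by linarith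
  have h2' : ∫ x in Ioi a, (w₁ x - ψp x / φp x * w x) ^ 2 = 0 := by linarith
  rw [setIntegral_eq_zero_iff_of_nonneg_ae (ae_of_all _ fun x => sq_nonneg _)
    (h.solm.integrable_sub_sq h.posm h.abs_div_le_m hw.isH1).integrableOn, EventuallyEq,
    ae_restrict_iff' measurableSet_Iic] at h1'
  rw [setIntegral_eq_zero_iff_of_nonneg_ae (ae_of_all _ fun x => sq_nonneg _)
    (h.solp.integrable_sub_sq h.posp h.abs_div_le_p hw.isH1).integrableOn, EventuallyEq,
    ae_restrict_iff' measurableSet_Ioi] at h2'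
  funext x
  rcases le_total x a with hx | hx
  · have hq := (h.solm.isPrimitive_quotient h.posm hw.isH1.isPrimitive).integral_eq a x
    rw [intervalIntegral.integral_zero_ae (by
      filter_upwards [h1'] with t ht htx
      rw [uIoc_of_ge hx] at htx
      rw [pow_eq_zero_iff two_ne_zero |>.1 (ht htx.2), zero_div]), hw.value, eq_comm,
      sub_eq_zero, div_eq_iff (h.posm x).ne'] at hq
    rw [hq, peak_of_le hx]
    ring
  · have hq := (h.solp.isPrimitive_quotient h.posp hw.isH1.isPrimitive).integral_eq a x
    rw [intervalIntegral.integral_zero_ae (by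
      filter_upwards [h2'] with t ht htx
      rw [uIoc_of_le hx] at htx
      rw [pow_eq_zero_iff two_ne_zero |>.1 (ht htx.1), zero_div]), hw.value, eq_comm,
      sub_eq_zero, div_eq_iff (h.posp x).ne'] at hq
    rw [hq, h.peak_of_ge hx]
    ring

theorem infK_eq (hV : IsPotential V v₀ v₁) (h : IsDecayingPair V c φp ψp φm ψm) (a : ℝ) :
    infK V a = ψm a / φm a - ψp a / φp a := by
  rw [← h.energy_peak hV]
  refine IsLeast.csInf_eq ⟨⟨_, _, h.isInK_peak a, rfl⟩, ?_⟩
  rintro _ ⟨w, w₁, hw, rfl⟩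
  exact h.energy_peak_le hV hw

end IsDecayingPair

/-! ### Local `W^{2,∞}` regularity. -/

theorem IsLInftyLoc.mul {f g : ℝ → ℝ} (hf : IsLInftyLoc f) (hg : IsLInftyLoc g) :
    IsLInftyLoc (fun x => f x * g x) := fun K hK => MemLp.mul' (hg K hK) (hf K hK)

theorem IsLInftyLoc.add {f g : ℝ → ℝ} (hf : IsLInftyLoc f) (hg : IsLInftyLoc g) :
    IsLInftyLoc (fun x => f x + g x) := fun K hK => (hf K hK).add (hg K hK)

theorem IsLInftyLoc.sub {f g : ℝ → ℝ} (hf : IsLInftyLoc f) (hg : IsLInftyLoc g) :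
    IsLInftyLoc (fun x => f x - g x) := fun K hK => (hf K hK).sub (hg K hK)

/-- The pointwise `deriv g` agrees with `k` only a.e., which is enough for a weak derivative. -/
theorem isW2InftyLoc_of_isPrimitive {f g k : ℝ → ℝ} (hf : ∀ x, HasDerivAt f (g x) x)
    (hg : IsPrimitive g k) (hk : IsLInftyLoc k) :
    IsW2InftyLoc f (deriv f) (deriv (deriv f)) := by
  have hd : deriv f = g := funext fun x => (hf x).deriv
  have hc : Continuous f := continuous_iff_continuousAt.2 fun x => (hf x).continuousAt
  rw [hd]
  exact ⟨hc, (IsPrimitive.of_hasDerivAt hf hg.continuous).hasWeakDeriv,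
    hg.deriv_self.hasWeakDeriv, hc.isLInftyLoc, hg.continuous.isLInftyLoc,
    hk.congr (by filter_upwards [hg.ae_deriv] with x hx using hx.symm)⟩

namespace IsSol

variable {V φ ψ : ℝ → ℝ} {v₀ v₁ : ℝ}

theorem deriv_logFun (h : IsSol V φ ψ) (h0 : ∀ x, 0 < φ x) :
    deriv (logFun φ) = fun x => ψ x / φ x := funext fun x => (h.hasDerivAt_log h0 x).deriv

theorem isW2InftyLoc_logFun (hV : IsPotential V v₀ v₁) (h : IsSol V φ ψ) (h0 : ∀ x, 0 < φ x) :
    IsW2InftyLoc (logFun φ) (deriv (logFun φ)) (deriv (deriv (logFun φ))) :=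
  isW2InftyLoc_of_isPrimitive (h.hasDerivAt_log h0) (h.isPrimitive_div h0)
    (hV.isLInftyLoc.sub ((h.continuous_div h0).pow 2).isLInftyLoc)

theorem ae_hasDerivAt_deriv_logFun (h : IsSol V φ ψ) (h0 : ∀ x, 0 < φ x) :
    ∀ᵐ x, HasDerivAt (deriv (logFun φ)) (V x - (ψ x / φ x) ^ 2) x := by
  rw [h.deriv_logFun h0]
  exact (h.isPrimitive_div h0).ae_hasDerivAt

theorem deriv_sqFun (h : IsSol V φ ψ) (x : ℝ) : deriv (sqFun φ) x = 2 * (φ x * ψ x) :=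
  (h.hasDerivAt_sq x).deriv

end IsSol

/-! ### Wronskian identities, the integrals `H±`, and the derivatives of `F`. -/

namespace IsDecayingPair

variable {V φp ψp φm ψm : ℝ → ℝ} {v₀ v₁ c : ℝ}

theorem wronskian_eq (h : IsDecayingPair V c φp ψp φm ψm) (x : ℝ) :
    φp x * ψm x - ψp x * φm x = ψm 0 - ψp 0 := by
  rw [h.solp.wronskian h.solm x 0, h.zerop, h.zerom]
  ring

/-- If `W` were `0`, then `φ₊` and `φ₋` would share their data at `0` and coincide, but `φ₊ ≥ 1` on
`(-∞, 0]` while `φ₋ → 0` there. -/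
theorem wronskian_pos (hV : IsPotential V v₀ v₁) (h : IsDecayingPair V c φp ψp φm ψm) :
    0 < ψm 0 - ψp 0 := by
  refine lt_of_le_of_ne (by linarith [h.nonpos 0, h.nonneg 0]) fun h0 => ?_
  have he : ∀ x, φp x - φm x = 0 := (h.solp.sub h.solm).eq_zero hV (a := 0)
    (by simp [h.zerop, h.zerom]) (by linarith)
  have : (1 : ℝ) ≤ 0 := ge_of_tendsto h.tendsto_m (by
    filter_upwards [eventually_le_atBot 0] with x hx
    rw [← sub_eq_zero.1 (he x), ← h.zerop]
    exact h.antitone hx)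
  linarith

theorem hasDerivAt_quotient_m (h : IsDecayingPair V c φp ψp φm ψm) (x : ℝ) :
    HasDerivAt (fun x => φm x / φp x) ((ψm 0 - ψp 0) * (1 / sqFun φp x)) x := by
  refine ((h.solm.hasDerivAt x).div (h.solp.hasDerivAt x) (h.posp x).ne').congr_deriv ?_
  rw [← h.wronskian_eq x, sqFun]
  ring

theorem hasDerivAt_quotient_p (h : IsDecayingPair V c φp ψp φm ψm) (x : ℝ) :
    HasDerivAt (fun x => φp x / φm x) (-((ψm 0 - ψp 0) * (1 / sqFun φm x))) x := by
  refine ((h.solp.hasDerivAt x).div (h.solm.hasDerivAt x) (h.posm x).ne').congr_deriv ?_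
  rw [← h.wronskian_eq x, sqFun]
  ring

theorem tendsto_quotient_m (h : IsDecayingPair V c φp ψp φm ψm) :
    Tendsto (fun x => φm x / φp x) atBot (𝓝 0) := by
  refine tendsto_of_tendsto_of_tendsto_of_le_of_le' tendsto_const_nhds h.tendsto_m
    (Eventually.of_forall fun x => (div_pos (h.posm x) (h.posp x)).le) ?_
  filter_upwards [eventually_le_atBot 0] with x hx
  exact div_le_self (h.posm x).le (h.zerop ▸ h.antitone hx)

theorem tendsto_quotient_p (h : IsDecayingPair V c φp ψp φm ψm) :
    Tendsto (fun x => φp x / φm x) atTop (𝓝 0) := by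
  refine tendsto_of_tendsto_of_tendsto_of_le_of_le' tendsto_const_nhds h.tendsto_p
    (Eventually.of_forall fun x => (div_pos (h.posp x) (h.posm x)).le) ?_
  filter_upwards [eventually_ge_atTop 0] with x hx
  exact div_le_self (h.posp x).le (h.zerom ▸ h.monotone hx)

theorem continuous_one_div_sq {φ : ℝ → ℝ} (hφ : Continuous φ) (h0 : ∀ x, 0 < φ x) :
    Continuous fun x => 1 / sqFun φ x :=
  continuous_const.div (hφ.pow 2) fun x => (pow_pos (h0 x) 2).ne'

/-- The quotient `φ₋/φ₊` has derivative `W/φ₊² ≥ 0` and limit `0` at `-∞`; this gives both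
integrability and the value of the integral. -/
theorem HPlus_eq (hV : IsPotential V v₀ v₁) (h : IsDecayingPair V c φp ψp φm ψm) (x : ℝ) :
    IntegrableOn (fun ξ => 1 / sqFun φp ξ) (Iic x) ∧
      φm x = (ψm 0 - ψp 0) * φp x * HPlus φp x := by
  have hW := h.wronskian_pos hV
  have hp := IsPrimitive.of_hasDerivAt h.hasDerivAt_quotient_m
    ((continuous_one_div_sq h.solp.continuous h.posp).const_mul _)
  have hi := hp.integrableOn_Iic_of_nonneg
    (fun x => mul_nonneg hW.le (one_div_nonneg.2 (sq_nonneg _))) h.tendsto_quotient_m x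
  have he := hp.integral_Iic hi h.tendsto_quotient_m
  rw [integral_const_mul, sub_zero, eq_div_iff (h.posp x).ne'] at he
  refine ⟨?_, ?_⟩
  · simpa [IntegrableOn, hW.ne'] using Integrable.const_mul hi (ψm 0 - ψp 0)⁻¹
  · rw [HPlus, ← he]; ring

theorem HMinus_eq (hV : IsPotential V v₀ v₁) (h : IsDecayingPair V c φp ψp φm ψm) (x : ℝ) :
    IntegrableOn (fun ξ => 1 / sqFun φm ξ) (Ici x) ∧
      φp x = (ψm 0 - ψp 0) * φm x * HMinus φm x := by
  have hW := h.wronskian_pos hV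
  have hp := (IsPrimitive.of_hasDerivAt h.hasDerivAt_quotient_p
    ((continuous_one_div_sq h.solm.continuous h.posm).const_mul _).neg).neg
  have hi := hp.integrableOn_Ici_of_nonneg (l := 0)
    (fun x => by
      rw [neg_neg]; exact mul_nonneg hW.le (one_div_nonneg.2 (sq_nonneg _)))
    (by simpa using h.tendsto_quotient_p.neg) x
  have he := hp.integral_Ioi (l := 0) (hi.mono_set Ioi_subset_Ici_self)
    (by simpa using h.tendsto_quotient_p.neg)
  simp only [neg_neg] at he hi
  rw [integral_const_mul, sub_neg_eq_add, zero_add, eq_div_iff (h.posm x).ne'] at he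
  refine ⟨?_, ?_⟩
  · simpa [IntegrableOn, hW.ne'] using Integrable.const_mul hi (ψm 0 - ψp 0)⁻¹
  · rw [HMinus, integral_Ici_eq_integral_Ioi, ← he]; ring

/-- Over a common denominator the numerator of `r₋ - r₊` is the Wronskian, so differentiating `F`
involves no derivative of `r±`. -/
theorem infK_eq_div (hV : IsPotential V v₀ v₁) (h : IsDecayingPair V c φp ψp φm ψm) (x : ℝ) :
    infK V x = (ψm 0 - ψp 0) / (φp x * φm x) := by
  have := (h.posp x).ne'
  have := (h.posm x).ne'
  rw [h.infK_eq hV, ← h.wronskian_eq x]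
  field_simp

theorem hasDerivAt_infK (hV : IsPotential V v₀ v₁) (h : IsDecayingPair V c φp ψp φm ψm) (x : ℝ) :
    HasDerivAt (infK V) (-infK V x * (ψp x / φp x + ψm x / φm x)) x := by
  have hp := (h.posp x).ne'
  have hm := (h.posm x).ne'
  rw [h.infK_eq_div hV, funext (h.infK_eq_div hV)]
  refine ((hasDerivAt_const x (ψm 0 - ψp 0)).div
    ((h.solp.hasDerivAt x).mul (h.solm.hasDerivAt x)) (mul_ne_zero hp hm)).congr_deriv ?_
  field_simp
  simp
  ring

theorem isPrimitive_deriv_infK (hV : IsPotential V v₀ v₁)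
    (h : IsDecayingPair V c φp ψp φm ψm) :
    IsPrimitive (fun x => -infK V x * (ψp x / φp x + ψm x / φm x))
      (fun x => -(-infK V x * (ψp x / φp x + ψm x / φm x)) * (ψp x / φp x + ψm x / φm x) +
        -infK V x * ((V x - (ψp x / φp x) ^ 2) + (V x - (ψm x / φm x) ^ 2))) := by
  have hd := h.hasDerivAt_infK hV
  have hr := (h.solp.isPrimitive_div h.posp).add (h.solm.isPrimitive_div h.posm)
  have hc : Continuous (infK V) := continuous_iff_continuousAt.2 fun x => (hd x).continuousAt
  exact (IsPrimitive.of_hasDerivAt hd (hc.neg.mul hr.continuous)).neg.mul hr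

theorem isW2InftyLoc_infK (hV : IsPotential V v₀ v₁) (h : IsDecayingPair V c φp ψp φm ψm) :
    IsW2InftyLoc (infK V) (deriv (infK V)) (deriv (deriv (infK V))) := by
  have hd := h.hasDerivAt_infK hV
  have hp := h.solp.continuous_div h.posp
  have hm := h.solm.continuous_div h.posm
  have hc : Continuous (infK V) := continuous_iff_continuousAt.2 fun x => (hd x).continuousAt
  exact isW2InftyLoc_of_isPrimitive hd (h.isPrimitive_deriv_infK hV)
    (((hc.neg.mul (hp.add hm)).neg.mul (hp.add hm)).isLInftyLoc.add
      (hc.neg.isLInftyLoc.mul ((hV.isLInftyLoc.sub (hp.pow 2).isLInftyLoc).add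
        (hV.isLInftyLoc.sub (hm.pow 2).isLInftyLoc))))

theorem hasDerivWithinAt_peak_Ioi (h : IsDecayingPair V c φp ψp φm ψm) (x : ℝ) :
    HasDerivWithinAt (peak φp φm x) (ψp x / φp x) (Ioi x) x :=
  ((h.solp.hasDerivAt x).div_const (φp x)).hasDerivWithinAt.congr
    (fun _ hy => h.peak_of_ge (le_of_lt hy)) (h.peak_of_ge le_rfl)

theorem hasDerivWithinAt_peak_Iio (h : IsDecayingPair V c φp ψp φm ψm) (x : ℝ) :
    HasDerivWithinAt (peak φp φm x) (ψm x / φm x) (Iio x) x :=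
  ((h.solm.hasDerivAt x).div_const (φm x)).hasDerivWithinAt.congr
    (fun _ hy => peak_of_le (le_of_lt hy)) (peak_of_le le_rfl)

end IsDecayingPair

/-! ### Assembly of the representation formulas. -/

theorem mainTheorem10 (V : ℝ → ℝ) (v₀ v₁ : ℝ) (hV : MemLp V ∞ volume) (hv₀ : 0 < v₀)
    (hbound : ∀ᵐ x, v₀ ≤ V x ∧ V x ≤ v₁) :
    -- the objects of the statement exist and are unique
    (∃! φ : ℝ → ℝ, IsDecayingSolution V atTop φ) ∧
    (∃! φ : ℝ → ℝ, IsDecayingSolution V atBot φ) ∧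
    (∀ a : ℝ, ∃! w : ℝ → ℝ, IsMinimizerK V a w) ∧
    ∀ (φp φm : ℝ → ℝ) (u : ℝ → ℝ → ℝ) (W : ℝ),
      IsDecayingSolution V atTop φp → IsDecayingSolution V atBot φm →
      (∀ a : ℝ, IsMinimizerK V a (u a)) →
      W = deriv φm 0 - deriv φp 0 →
      -- all expressions below are well defined
      (Differentiable ℝ φp ∧ Differentiable ℝ φm) ∧
      (∀ x, 0 < φp x ∧ 0 < φm x) ∧
      (∀ x, IntegrableOn (fun ξ => 1 / sqFun φp ξ) (Iic x) volume ∧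
        IntegrableOn (fun ξ => 1 / sqFun φm ξ) (Ici x) volume) ∧
      (Differentiable ℝ (logFun φp) ∧ Differentiable ℝ (logFun φm)) ∧
      IsW2InftyLoc (logFun φp) (deriv (logFun φp)) (deriv (deriv (logFun φp))) ∧
      IsW2InftyLoc (logFun φm) (deriv (logFun φm)) (deriv (deriv (logFun φm))) ∧
      IsW2InftyLoc (infK V) (deriv (infK V)) (deriv (deriv (infK V))) ∧
      (∀ᵐ x, DifferentiableAt ℝ (deriv (logFun φp)) x ∧
        DifferentiableAt ℝ (deriv (logFun φm)) x ∧ DifferentiableAt ℝ (deriv (infK V)) x) ∧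
      -- positivity of `W`
      0 < W ∧
      -- one-sided derivatives of the minimizer at its peak
      (∀ x, HasDerivWithinAt (u x) (deriv φp x / φp x) (Ioi x) x ∧
        deriv φp x / φp x = deriv (logFun φp) x) ∧
      (∀ x, HasDerivWithinAt (u x) (deriv φm x / φm x) (Iio x) x ∧
        deriv φm x / φm x = deriv (logFun φm) x) ∧
      -- each of `φ₊`, `φ₋` in terms of the other
      (∀ x, φm x = W * φp x * HPlus φp x) ∧
      (∀ x, φp x = W * φm x * HMinus φm x) ∧
      -- representation of the potential
      (∀ᵐ x, V x = deriv (deriv (logFun φp)) x + (deriv (logFun φp) x) ^ 2) ∧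
      (∀ᵐ x, V x = deriv (deriv (logFun φm)) x + (deriv (logFun φm) x) ^ 2) ∧
      -- formula for `F`
      (∀ x, infK V x = deriv (logFun φm) x - deriv (logFun φp) x) ∧
      -- formulas for `F'`
      (∀ x, HasDerivAt (infK V)
        (-infK V x * (deriv (logFun φp) x + deriv (logFun φm) x)) x) ∧
      (∀ x, deriv (infK V) x =
        -(W * infK V x / (φp x * φm x)) * (deriv (sqFun φp) x * HPlus φp x + 1)) ∧
      (∀ x, deriv (infK V) x =
        -(W * infK V x / (φp x * φm x)) * (deriv (sqFun φm) x * HMinus φm x - 1)) ∧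
      -- formulas for `F''`
      (∀ᵐ x, deriv (deriv (infK V)) x =
        -2 * deriv (infK V) x * deriv (logFun φm) x
          - 2 * infK V x * deriv (deriv (logFun φp)) x) ∧
      (∀ᵐ x, deriv (deriv (infK V)) x =
        -2 * deriv (infK V) x * deriv (logFun φp) x
          - 2 * infK V x * deriv (deriv (logFun φm)) x) := by
  have hP : IsPotential V v₀ v₁ := ⟨hV.aestronglyMeasurable, hv₀, hbound⟩
  refine ⟨IsDecayingSolution.existsUnique hP, IsDecayingSolution.existsUnique_atBot hP, ?_, ?_⟩
  · intro a
    obtain ⟨φp, hp, -⟩ := IsDecayingSolution.existsUnique hP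
    obtain ⟨φm, hm, -⟩ := IsDecayingSolution.existsUnique_atBot hP
    obtain ⟨ψp, ψm, h⟩ := hp.exists_pair hP hm
    exact ⟨peak φp φm a, h.isMinimizerK_peak hP a, fun w hw => h.eq_peak hP hw⟩
  intro φp φm u W hp hm hu hW
  obtain ⟨ψp, ψm, h⟩ := hp.exists_pair hP hm
  have hu' : ∀ a, u a = peak φp φm a := fun a => h.eq_peak hP (hu a)
  have hdp := h.solp.deriv_eq
  have hdm := h.solm.deriv_eq
  have hlp := h.solp.deriv_logFun h.posp
  have hlm := h.solm.deriv_logFun h.posm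
  have hF := h.hasDerivAt_infK hP
  have hF' : deriv (infK V) = fun x => -infK V x * (ψp x / φp x + ψm x / φm x) :=
    funext fun x => (hF x).deriv
  have hll_p := h.solp.ae_hasDerivAt_deriv_logFun h.posp
  have hll_m := h.solm.ae_hasDerivAt_deriv_logFun h.posm
  have hFF := (h.isPrimitive_deriv_infK hP).ae_hasDerivAt
  rw [← hF'] at hFF
  have hWeq : W = ψm 0 - ψp 0 := by rw [hW, hdp, hdm]
  have hWpos : 0 < W := hWeq ▸ h.wronskian_pos hP
  have hwr : ∀ x, φp x * ψm x - ψp x * φm x = W := fun x => by rw [hWeq, h.wronskian_eq]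
  have hHp : ∀ x, φm x = W * φp x * HPlus φp x := fun x => hWeq ▸ (h.HPlus_eq hP x).2
  have hHm : ∀ x, φp x = W * φm x * HMinus φm x := fun x => hWeq ▸ (h.HMinus_eq hP x).2
  refine ⟨⟨fun x => (h.solp.hasDerivAt x).differentiableAt,
    fun x => (h.solm.hasDerivAt x).differentiableAt⟩, fun x => ⟨h.posp x, h.posm x⟩,
    fun x => ⟨(h.HPlus_eq hP x).1, (h.HMinus_eq hP x).1⟩,
    ⟨fun x => (h.solp.hasDerivAt_log h.posp x).differentiableAt,
    fun x => (h.solm.hasDerivAt_log h.posm x).differentiableAt⟩,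
    h.solp.isW2InftyLoc_logFun hP h.posp, h.solm.isW2InftyLoc_logFun hP h.posm,
    h.isW2InftyLoc_infK hP, ?_, hWpos, fun x => ⟨?_, ?_⟩, fun x => ⟨?_, ?_⟩, hHp, hHm,
    ?_, ?_, fun x => ?_, fun x => ?_, fun x => ?_, fun x => ?_, ?_, ?_⟩
  · filter_upwards [hll_p, hll_m, hFF] with x h1 h2 h3
    exact ⟨h1.differentiableAt, h2.differentiableAt, h3.differentiableAt⟩
  · rw [hu', hdp]; exact h.hasDerivWithinAt_peak_Ioi x
  · rw [hlp, hdp]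
  · rw [hu', hdm]; exact h.hasDerivWithinAt_peak_Iio x
  · rw [hlm, hdm]
  · filter_upwards [hll_p] with x h1
    rw [h1.deriv, hlp]; ring
  · filter_upwards [hll_m] with x h1
    rw [h1.deriv, hlm]; ring
  · rw [hlp, hlm, h.infK_eq hP]
  · rw [hlp, hlm]; exact hF x
  · have h1 := (h.posp x).ne'
    have h2 := (h.posm x).ne'
    -- Since `h₊' = 2 φ₊ φ₊'` and `W φ₊ H₊ = φ₋`, the left side is `2 φ₊' φ₋ + W`; expanding `W`
    -- symmetrizes it.
    have h3 : W * (deriv (sqFun φp) x * HPlus φp x + 1) = φp x * ψm x + ψp x * φm x := by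
      rw [h.solp.deriv_sqFun]
      linear_combination (-2 * ψp x) * hHp x - hwr x
    have h4 : ∀ X, -(W * infK V x / (φp x * φm x)) * X =
        -(infK V x / (φp x * φm x)) * (W * X) := fun X => by ring
    rw [hF', h4, h3]
    field_simp
    ring
  · have h1 := (h.posp x).ne'
    have h2 := (h.posm x).ne'
    have h3 : W * (deriv (sqFun φm) x * HMinus φm x - 1) = φp x * ψm x + ψp x * φm x := by
      rw [h.solm.deriv_sqFun]
      linear_combination (-2 * ψm x) * hHm x + hwr x
    have h4 : ∀ X, -(W * infK V x / (φp x * φm x)) * X =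
        -(infK V x / (φp x * φm x)) * (W * X) := fun X => by ring
    rw [hF', h4, h3]
    field_simp
    ring
  · filter_upwards [hll_p, hFF] with x h1 h2
    rw [h1.deriv, h2.deriv, hF', hlm]
    -- With `F = r₋ - r₊`, and so `F' = r₊² - r₋²`, the claim is a polynomial identity in `V` and
    -- `r±`.
    simp only [h.infK_eq hP]
    ring
  · filter_upwards [hll_m, hFF] with x h1 h2
    rw [h1.deriv, h2.deriv, hF', hlp]
    simp only [h.infK_eq hP]
    ring
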